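/- Let $m\ge 1$ be an integer and let $c\in\mathbb C\smallsetminus\mathbb Z_{\le 0}$. Put $X=\mathbb P^1(\mathbb C)\smallsetminus\{0,1,\infty\}$ with base point $-1$, let $\tilde X$ be its universal cover, viewed as the set of homotopy classes $[\gamma]$ of paths $\gamma$ in $X$ starting at $-1$, and compose paths from left to right (in $\tau\gamma$ one follows first $\tau$, then $\gamma$). For $|z|<1$ let $$Li_{m,c}(z)=z\,\Phi(m,z,c)=\sum_{n\ge 0}\frac{z^{n+1}}{(n+c)^m},$$ and consider the ordered list of $m+1$ functions $$\mathcal B_{m+1,c}=\Big(Li_{m,c}(z),\ \tfrac{1}{(m-1)!}z^{1-c}(\log z)^{m-1},\ \tfrac{1}{(m-2)!}z^{1-c}(\log z)^{m-2},\ \dots,\ z^{1-c}\Big),$$ with principal branches on $\{|z|<1,\ \operatorname{Im} z>0\}$; this half disc is embedded in $\tilde X$ by the paths that stay in the upper half plane after leaving $-1$. Then each of these functions has a unique analytic continuation to a holomorphic function on $\tilde X$; the continuations $b_0,\dots,b_m$ are linearly independent over $\mathbb C$, and their span is preserved by the translations $(Q_{[\tau]}f)([\gamma])=f([\tau\gamma])$,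 $[\tau]\in\pi_1(X,-1)$. Hence there is a unique homomorphism $\rho_{m,c}:\pi_1(X,-1)\to GL(m+1,\mathbb C)$, the monodromy representation, with $Q_{[\tau]}b_i=\sum_{j}\rho_{m,c}([\tau])_{ij}\,b_j$. Let $Z_0$ be a simple closed curve based at $-1$ that encloses $0$ once counterclockwise, does not enclose $1$ and does not meet $\{1-it:t\ge 0\}$, and let $Z_1$ be a simple closed curve based at $-1$ that encloses $1$ once counterclockwise and does not meet $\{-it:t\ge 0\}$. Then $$\rho_{m,c}([Z_0])=\begin{pmatrix} 1&0&0&\cdots&0\\ 0&e^{-2\pi i c}&\frac{2\pi i}{1!}e^{-2\pi i c}&\cdots&\frac{(2\pi i)^{m-1}}{(m-1)!}e^{-2\pi i c}\\ \vdots&&\ddots&\ddots&\vdots\\ 0&0&\cdots&e^{-2\pi i c}&\frac{2\pi i}{1!}e^{-2\pi i c}\\ 0&0&\cdots&0&e^{-2\pi i c}\end{pmatrix}, \qquad \rho_{m,c}([Z_1])=I-2\pi i\,E_{12},$$ that is, the lower right $m\times m$ block of $\rho_{m,c}([Z_0])$ has entries $e^{-2\pi i c}(2\pi i)^{l-k}/(l-k)!$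 for $1\le k\le l\le m$ and $0$ below the diagonal, and $E_{12}$ is the matrix with a single $1$, in the first row and second column. The image of $\rho_{m,c}$ lies in a Borel subgroup of $GL(m+1,\mathbb C)$. The image is unipotent (all its elements are unipotent) if $c$ is a positive integer, and it is quasi-unipotent (for some $N\ge 1$ the $N$-th powers of all its elements are unipotent) if $c\in\mathbb Q\smallsetminus\mathbb Z$. -/

import Mathlib

noncomputable section

namespace PolylogMonodromy

/-! ### The thrice punctured sphere, its universal cover and its fundamental group -/

/-- `ℙ¹(ℂ) ∖ {0, 1, ∞} = ℂ ∖ {0, 1}`. -/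
abbrev PuncturedPlane : Type := {z : ℂ // z ≠ 0 ∧ z ≠ 1}

/-- The base point `-1`. -/
def base : PuncturedPlane := ⟨-1, by norm_num, by norm_num⟩

/-- The universal cover: an end point `z` together with a homotopy class (with fixed end points)
of paths from `-1` to `z`. -/
abbrev UCover : Type := Σ z : PuncturedPlane, Path.Homotopic.Quotient base z

/-- The fundamental group `π₁(ℙ¹(ℂ) ∖ {0, 1, ∞}, -1)`, with loops composed from left to right:
the product `[τ][σ]` means first `τ`, then `σ`. (Mathlib's `FundamentalGroup` composes in the
other order, hence the opposite group.) -/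
abbrev Pi1 : Type := (FundamentalGroup PuncturedPlane base)ᵐᵒᵖ

/-- The element of `Pi1` given by a homotopy class of loops. -/
def Pi1.ofLoop (τ : Path.Homotopic.Quotient base base) : Pi1 :=
  MulOpposite.op (FundamentalGroup.fromPath τ)

/-- The homotopy class of loops underlying an element of `Pi1`. -/
def Pi1.toLoop (τ : Pi1) : Path.Homotopic.Quotient base base :=
  FundamentalGroup.toPath τ.unop

/-- The product in `Pi1` is composition of loops from left to right. -/
theorem Pi1.toLoop_mul (τ σ : Pi1) : (τ * σ).toLoop = τ.toLoop.trans σ.toLoop := rfl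

/-! ### The loops `Z₀` and `Z₁` -/

theorem circleMap_ne {a : ℂ} {r : ℝ} (w : ℂ) (h : ‖w - a‖ ≠ |r|) (θ : ℝ) :
    circleMap a r θ ≠ w := by
  intro e
  apply h
  rw [← e]
  simp

/-- The circular arc `a + r e^{iθ}`, with `θ` running at constant speed from `θ₀` to `θ₁`,
on a circle that contains neither `0` nor `1`. -/
def arc (a : ℂ) (r : ℝ) (h₀ : ‖(0 : ℂ) - a‖ ≠ |r|) (h₁ : ‖(1 : ℂ) - a‖ ≠ |r|) (θ₀ θ₁ : ℝ)
    (x y : PuncturedPlane) (hx : circleMap a r θ₀ = x) (hy : circleMap a r θ₁ = y) :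
    Path x y where
  toFun t := ⟨circleMap a r (θ₀ + (t : ℝ) * (θ₁ - θ₀)), circleMap_ne 0 h₀ _, circleMap_ne 1 h₁ _⟩
  continuous_toFun := by
    refine Continuous.subtype_mk ?_ _
    exact (continuous_circleMap a r).comp (by fun_prop)
  source' := by
    apply Subtype.ext
    simpa using hx
  target' := by
    apply Subtype.ext
    simpa using hy

theorem exp_pi_I_three : Complex.exp (((3 * Real.pi : ℝ) : ℂ) * Complex.I) = -1 := by
  have h : (((3 * Real.pi : ℝ) : ℂ) * Complex.I)
      = (Real.pi : ℂ) * Complex.I + 2 * Real.pi * Complex.I := by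
    push_cast; ring
  rw [h, Complex.exp_add, Complex.exp_pi_mul_I, Complex.exp_two_pi_mul_I]; ring

/-- `Z₀` : the circle with centre `-1/4` and radius `3/4`, run through once counterclockwise from
`-1`. It is a simple closed curve that encloses `0` but not `1`. -/
def loopZ0 : Path base base :=
  arc (-1 / 4) (3 / 4) (by norm_num) (by norm_num) Real.pi (3 * Real.pi) base base
    (by
      simp only [circleMap, base, Complex.exp_pi_mul_I]; push_cast; norm_num)
    (by
      simp only [circleMap, base, exp_pi_I_three]; push_cast; norm_num)

/-- The point `1/2`. -/
def half : PuncturedPlane := ⟨1 / 2, by norm_num, by norm_num⟩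

/-- The half circle in the upper half plane from `-1` to `1/2` (run through clockwise). -/
def upperArc : Path base half :=
  arc (-1 / 4) (3 / 4) (by norm_num) (by norm_num) Real.pi 0 base half
    (by
      simp only [circleMap, base, Complex.exp_pi_mul_I]; push_cast; norm_num)
    (by
      simp [circleMap, half]; norm_num)

/-- The circle with centre `1` and radius `1/2`, run through once counterclockwise from `1/2`. -/
def circleAroundOne : Path half half :=
  arc 1 (1 / 2) (by norm_num) (by norm_num) Real.pi (3 * Real.pi) half half
    (by
      simp only [circleMap, half, Complex.exp_pi_mul_I]; push_cast; norm_num)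
    (by
      simp only [circleMap, half, exp_pi_I_three]; push_cast; norm_num)

/-- `Z₁` : go from `-1` to `1/2` through the upper half plane, then once counterclockwise around
`1`, then back. It is homotopic to a simple closed curve that encloses `1` counterclockwise and
does not meet `{-it : t ≥ 0}`. -/
def loopZ1 : Path base base :=
  upperArc.trans (circleAroundOne.trans upperArc.symm)

/-- The class `[Z₀]`. -/
def classZ0 : Pi1 := Pi1.ofLoop (Path.Homotopic.Quotient.mk loopZ0)

/-- The class `[Z₁]`. -/
def classZ1 : Pi1 := Pi1.ofLoop (Path.Homotopic.Quotient.mk loopZ1)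

/-! ### Analytic continuation to the universal cover -/

/-- A function on the universal cover is holomorphic if near each point it is a holomorphic
function of the coordinate `z`: for each class `[γ]` with end point `z`, continuing `γ` by short
paths `σ` inside a small disc around `z` gives a holomorphic function of the end point of `σ`. -/
def IsHolomorphic (F : UCover → ℂ) : Prop :=
  ∀ (z : PuncturedPlane) (γ : Path.Homotopic.Quotient base z),
    ∃ r : ℝ, 0 < r ∧ ∃ g : ℂ → ℂ, DifferentiableOn ℂ g (Metric.ball (z : ℂ) r) ∧
      ∀ (w : PuncturedPlane) (σ : Path z w), (∀ t, (σ t : ℂ) ∈ Metric.ball (z : ℂ) r) →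
        F ⟨w, γ.trans (Path.Homotopic.Quotient.mk σ)⟩ = g w

/-- `F` is the analytic continuation to the universal cover of the function `f`, given on the half
disc `{|z| < 1, Im z > 0}`; this half disc is embedded in the universal cover by means of the paths
that, after leaving `-1`, stay in the upper half plane. -/
def IsAnalyticContinuation (f : ℂ → ℂ) (F : UCover → ℂ) : Prop :=
  IsHolomorphic F ∧
    ∀ (z : PuncturedPlane) (γ : Path base z),
      (∀ t : unitInterval, 0 < t → 0 < (γ t : ℂ).im) → ‖(z : ℂ)‖ < 1 →
        F ⟨z, Path.Homotopic.Quotient.mk γ⟩ = f z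

/-- The translated function `Q_[τ] F : [γ] ↦ F([τγ])` (first follow `τ`, then `γ`). -/
def translate (τ : Pi1) (F : UCover → ℂ) : UCover → ℂ :=
  fun p => F ⟨p.1, τ.toLoop.trans p.2⟩

/-! ### The functions -/

/-- The `c`-deformed polylogarithm `Li_{m,c}(z) = z Φ(m, z, c) = ∑_{n ≥ 0} z^{n+1} / (n + c)^m`,
for `|z| < 1`. -/
def deformedPolylog (m : ℕ) (c z : ℂ) : ℂ :=
  ∑' n : ℕ, z ^ (n + 1) / ((n : ℂ) + c) ^ m

/-- The basis, in the order `Li_{m,c}(z)`, `z^{1-c} (log z)^{m-1} / (m-1)!`,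
`z^{1-c} (log z)^{m-2} / (m-2)!`, …, `z^{1-c}`, with principal branches. -/
def basisFn (m : ℕ) (c : ℂ) (i : Fin (m + 1)) (z : ℂ) : ℂ :=
  if i = 0 then deformedPolylog m c z
  else z ^ (1 - c) * Complex.log z ^ (m - (i : ℕ)) / ((m - (i : ℕ)).factorial : ℂ)

/-! ### The monodromy representation -/

/-- `ρ` is the matrix form of the monodromy action on the span of the functions `b i`, the `b i`
being arranged in a column: `Q_[τ] (b i) = ∑ j, ρ([τ])_{i j} b j`. -/
def IsMonodromyRep {n : ℕ} (b : Fin n → UCover → ℂ) (ρ : Pi1 →* GL (Fin n) ℂ) : Prop :=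
  ∀ (τ : Pi1) (i : Fin n),
    translate τ (b i) = ∑ j, (ρ τ : Matrix (Fin n) (Fin n) ℂ) i j • b j

/-- The matrix of `[Z₀]`. -/
def matrixZ0 (m : ℕ) (c : ℂ) : Matrix (Fin (m + 1)) (Fin (m + 1)) ℂ :=
  Matrix.of fun i j =>
    if i = 0 then (if j = 0 then 1 else 0)
    else if i ≤ j then
      (2 * Real.pi * Complex.I) ^ ((j : ℕ) - (i : ℕ)) / (((j : ℕ) - (i : ℕ)).factorial : ℂ)
        * Complex.exp (-(2 * Real.pi * Complex.I * c))
    else 0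

/-- The matrix of `[Z₁]`. -/
def matrixZ1 (m : ℕ) : Matrix (Fin (m + 1)) (Fin (m + 1)) ℂ :=
  Matrix.of fun i j =>
    if (i : ℕ) = 0 ∧ (j : ℕ) = 1 then -(2 * Real.pi * Complex.I)
    else if i = j then 1 else 0

/-! ### Subgroups of `GL(n, ℂ)` -/

/-- A Borel subgroup of `GL(n, ℂ)`: the stabilizer of a complete flag (a maximal chain of
subspaces) of `ℂⁿ`. -/
def IsBorelSubgroup {n : ℕ} (B : Subgroup (GL (Fin n) ℂ)) : Prop :=
  ∃ 𝓕 : Flag (Submodule ℂ (Fin n → ℂ)), ∀ g : GL (Fin n) ℂ,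
    g ∈ B ↔ ∀ U ∈ 𝓕, U.map (g : Matrix (Fin n) (Fin n) ℂ).mulVecLin = U

/-- A subgroup of `GL(n, ℂ)` is unipotent if `g - 1` is nilpotent for each of its elements `g`. -/
def IsUnipotentSubgroup {n : ℕ} (H : Subgroup (GL (Fin n) ℂ)) : Prop :=
  ∀ g ∈ H, IsNilpotent ((g : Matrix (Fin n) (Fin n) ℂ) - 1)

/-- A subgroup of `GL(n, ℂ)` is quasi-unipotent if some `N`-th power map, `N ≥ 1`, takes all of its
elements to unipotent ones. -/
def IsQuasiUnipotentSubgroup {n : ℕ} (H : Subgroup (GL (Fin n) ℂ)) : Prop :=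
  ∃ N : ℕ, 0 < N ∧ ∀ g ∈ H, IsNilpotent ((g : Matrix (Fin n) (Fin n) ℂ) ^ N - 1)

end PolylogMonodromy

end

open PolylogMonodromy

noncomputable section

namespace PolylogMonodromy

open Set Filter Topology Metric

/-! Put `ℓ = log z` and `u_k = z^{c-1} Li_{k,c}(z) = ∑ z^{n+c} / (n+c)^k`. Then `ℓ' = 1/z`, `z u₁' =
e^{cℓ}/(1-z)` and `z u_{k+1}' = u_k`. This system is triangular and regular away from `0` and `1`,
and the basis functions are `e^{(1-c)ℓ}` times `u_m` or times `ℓ^{m-i}/(m-i)!`. Continuing them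
therefore means transporting the values of the tuple `(ℓ, u₁, u₂, …)`. By `exists_transport` this is
the monodromy of a covering with discrete fibre `ℕ → ℂ`, so it depends only on the homotopy class of
the path. Uniqueness of the continuation is the identity theorem along paths,
`eq_of_agree_halfDisc`.

The monodromy comes from the symmetries `shift` of the system: `ℓ ↦ ℓ + a`, `u_k ↦ e^{ca} u_k +
h_k(ℓ)` with `h₀ = 0` and `h_{k+1}' = h_k`. Transport commutes with them (`transport_shift`), so a
loop that acts on the initial value at `-1` by a symmetry acts by the same symmetry over the whole
universal cover. Every loop is of this kind (`exists_shift_initial`): `e^ℓ = z` forces `ℓ` to change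
by some `2πin`, and the polynomials `h_k` can take prescribed values at `πi`. Expanding in the basis
gives an upper triangular matrix with diagonal `1, e^{-2πinc}, …, e^{-2πinc}`, without any knowledge
of generators of `π₁`. The Borel, unipotent and quasi-unipotent statements follow from this shape.

The circle `Z₀` lies in the closed unit disc and meets its boundary only at `-1`, so the power
series, read as functions of `ℓ`, give `a = 2πi`, `h = 0` (`transport_loopZ0`). Near `1` one has
`u_k = R - ℓ^{k-1}/(k-1)! · log(1-z)` with `R` holomorphic, so turning around `1` gives `a = 0`,
`h_k = -2πi ℓ^{k-1}/(k-1)!` (`transport_loopZ1`). -/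

/-- Local parallel transport maps on the members of an open cover, independent of the member
containing the two points, extend to a transport along homotopy classes of paths. -/
theorem exists_transport {X V : Type*} [TopologicalSpace X] (B : X → Set X)
    (hB : ∀ x, IsOpen (B x)) (hxB : ∀ x, x ∈ B x) (T : X → X → V → V)
    (T_self : ∀ x v, T x x v = v)
    (T_trans : ∀ i, ∀ x ∈ B i, ∀ y ∈ B i, ∀ z ∈ B i, ∀ v, T y z (T x y v) = T x z v) :
    ∃ P : ∀ x y : X, Path.Homotopic.Quotient x y → V → V,
      (∀ (x y : X) (σ : Path x y) (s : unitInterval → V),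
        (∀ t, ∀ᶠ t' in 𝓝 t, T (σ t) (σ t') (s t) = s t') →
          P x y (Path.Homotopic.Quotient.mk σ) (s 0) = s 1) ∧
      (∀ (x y : X) (σ : Path x y) (v : V), ∃ s : unitInterval → V, s 0 = v ∧
        ∀ t, ∀ᶠ t' in 𝓝 t, T (σ t) (σ t') (s t) = s t') ∧
      ∀ (x y z : X) (γ : Path.Homotopic.Quotient x y) (δ : Path.Homotopic.Quotient y z) (v : V),
        P x z (γ.trans δ) v = P y z δ (P x y γ v) := by
  -- With a discrete fibre the bundle glued from the local transports is a covering, and its lifts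
  -- of paths are the flat sections.
  let _ : TopologicalSpace V := ⊥
  have : DiscreteTopology V := ⟨rfl⟩
  let Z : FiberBundleCore X X V :=
    { baseSet := B
      isOpen_baseSet := hB
      indexAt := id
      mem_baseSet_at := hxB
      -- The coordinate in chart `i` of a point over `b` is the value transported to the centre `i`.
      -- As `indexAt = id`, the vector stored over `x` is the value at `x` itself.
      coordChange := fun i j b v => T b j (T i b v)
      coordChange_self := fun i x hx v => by rw [T_trans i i (hxB i) x hx i (hxB i), T_self]
      continuousOn_coordChange := fun i j => by
        rintro ⟨b, v⟩ ⟨⟨hbi, hbj⟩, -⟩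
        refine ContinuousAt.continuousWithinAt ?_
        refine (continuousAt_const (y := T b j (T i b v))).congr ?_
        have h1 : ∀ᶠ p : X × V in 𝓝 (b, v), p.1 ∈ B i ∩ B j :=
          continuousAt_fst.eventually (((hB i).inter (hB j)).mem_nhds ⟨hbi, hbj⟩)
        have h2 : ∀ᶠ p : X × V in 𝓝 (b, v), p.2 = v :=
          (continuous_snd.tendsto ((b, v) : X × V)).eventually (p := fun w => w = v)
            (by rw [nhds_discrete]; exact rfl)
        filter_upwards [h1, h2] with p hp hv
        rw [hv, ← T_trans i i (hxB i) b hbi p.1 hp.1, T_trans j b hbj p.1 hp.2 j (hxB j)]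
      coordChange_comp := fun i j k x hx v => by
        rw [T_trans j x hx.1.2 j (hxB j) x hx.1.2, T_self] }
  have cov : IsCoveringMap (Bundle.TotalSpace.proj : Bundle.TotalSpace V Z.Fiber → X) :=
    FiberBundle.isCoveringMap
  -- Lifts of `σ` are the same as functions along `σ` that are locally related by `T`.
  have key : ∀ (σ : C(unitInterval, X)) (s : unitInterval → V),
      Continuous (fun t => (⟨σ t, s t⟩ : Bundle.TotalSpace V Z.Fiber)) ↔
        ∀ t, ∀ᶠ t' in 𝓝 t, T (σ t) (σ t') (s t) = s t' := by
    intro σ s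
    rw [continuous_iff_continuousAt]
    refine forall_congr' fun t => ?_
    rw [FiberBundle.continuousAt_totalSpace]
    have h0 : ∀ᶠ t' in 𝓝 t, σ t' ∈ B (σ t) :=
      σ.continuous.continuousAt.eventually ((hB _).mem_nhds (hxB _))
    have h1 : ContinuousAt (fun t' => T (σ t') (σ t) (T (σ t') (σ t') (s t'))) t ↔
        ∀ᶠ t' in 𝓝 t, T (σ t) (σ t') (s t) = s t' := by
      rw [ContinuousAt, nhds_discrete V, tendsto_pure]
      simp only [T_self]
      refine eventually_congr ?_
      filter_upwards [h0] with t' ht'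
      constructor
      · intro h
        rw [← h, T_trans _ _ ht' _ (hxB _) _ ht', T_self]
      · intro h
        rw [← h, T_trans _ _ (hxB _) _ ht' _ (hxB _), T_self]
    rw [← h1]
    exact ⟨fun h => h.2, fun h => ⟨σ.continuous.continuousAt, h⟩⟩
  let E := Bundle.TotalSpace V Z.Fiber
  let mkE : X → V → E := fun x v => ⟨x, v⟩
  refine ⟨fun x y γ v => (cov.monodromy γ ⟨mkE x v, rfl⟩).1.2, ?_, ?_, ?_⟩
  · intro x y σ s hs
    have hc := (key σ s).2 hs
    have h0 : (σ : C(unitInterval, X)) 0 = (mkE x (s 0)).proj := σ.source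
    have h := (cov.eq_liftPath_iff (γ := σ) (e := mkE x (s 0)) h0
      (Γ := fun t => mkE (σ t) (s t))).2 ⟨hc, rfl, congrArg (mkE · (s 0)) σ.source⟩
    change ((cov.liftPath (σ : C(unitInterval, X)) (mkE x (s 0)) h0) 1).2 = s 1
    exact (congrArg Bundle.TotalSpace.snd (congrFun h 1)).symm
  · intro x y σ v
    have h0 : (σ : C(unitInterval, X)) 0 = (mkE x v).proj := σ.source
    have hl := cov.liftPath_lifts (σ : C(unitInterval, X)) (mkE x v) h0
    let L := cov.liftPath (σ : C(unitInterval, X)) (mkE x v) h0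
    refine ⟨fun t => (L t).2, ?_, ?_⟩
    · have : L 0 = mkE x v := cov.liftPath_zero _ _ h0
      change (L 0).2 = (mkE x v).2
      rw [this]
    · refine (key σ _).1 ?_
      have : (fun t => mkE (σ t) (L t).2) = L := by
        funext t
        have ht : (L t).proj = σ t := congrFun hl t
        rw [← ht]
      change Continuous (fun t => mkE (σ t) (L t).2)
      rw [this]
      exact ContinuousMap.continuous _
  · intro x y z γ δ v
    dsimp only
    rw [cov.monodromy_trans_apply]
    refine congrArg (fun e => (cov.monodromy δ e).1.2) ?_
    have h : (cov.monodromy γ ⟨mkE x v, rfl⟩).1.proj = y :=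
      (cov.monodromy γ ⟨mkE x v, rfl⟩).2
    generalize cov.monodromy γ ⟨mkE x v, rfl⟩ = e
    obtain ⟨⟨a, b⟩, rfl⟩ := e
    rfl

/-! ### The polylogarithmic differential system and its symmetries -/

/-- The right hand side of the differential system `ℓ' = 1 / z`, `z u₁' = exp (c ℓ) / (1 - z)`,
`z u_{k+1}' = u_k`, satisfied by `ℓ = log z` and `u_k = z^{c-1} Li_{k,c}(z)`; the coordinate of
index `0` is `ℓ`, that of index `k ≥ 1` is `u_k`. -/
def rhs (c z : ℂ) (v : ℕ → ℂ) : ℕ → ℂ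
  | 0 => 1 / z
  | 1 => Complex.exp (c * v 0) / (1 - z) / z
  | k + 2 => v (k + 1) / z

/-- `S` is a solution on `U` of the polylogarithmic differential system. -/
def IsSol (c : ℂ) (U : Set ℂ) (S : ℂ → ℕ → ℂ) : Prop :=
  ∀ z ∈ U, ∀ k, HasDerivAt (fun w => S w k) (rhs c z (S z) k) z

theorem IsSol.mono {c : ℂ} {U U' : Set ℂ} {S : ℂ → ℕ → ℂ} (h : IsSol c U S) (hU : U' ⊆ U) :
    IsSol c U' S := fun z hz => h z (hU hz)

theorem IsSol.differentiableOn {c : ℂ} {U : Set ℂ} {S : ℂ → ℕ → ℂ} (h : IsSol c U S) (k : ℕ) :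
    DifferentiableOn ℂ (fun w => S w k) U :=
  fun z hz => (h z hz k).differentiableAt.differentiableWithinAt

theorem eqOn_of_hasDerivAt {U : Set ℂ} (hU : IsOpen U) (hc : IsPreconnected U) {f g f' : ℂ → ℂ}
    (hf : ∀ z ∈ U, HasDerivAt f (f' z) z) (hg : ∀ z ∈ U, HasDerivAt g (f' z) z) {y : ℂ}
    (hy : y ∈ U) (hfg : f y = g y) : EqOn f g U :=
  hU.eqOn_of_deriv_eq hc (fun z hz => (hf z hz).differentiableAt.differentiableWithinAt)
    (fun z hz => (hg z hz).differentiableAt.differentiableWithinAt)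
    (fun z hz => (hf z hz).deriv.trans (hg z hz).deriv.symm) hy hfg

/-- The system is triangular: once the lower coordinates agree, both `k`-th coordinates have the
same derivative, so induction on `k` suffices. -/
theorem IsSol.eqOn {c : ℂ} {U : Set ℂ} (hU : IsOpen U) (hc : IsPreconnected U)
    {S S' : ℂ → ℕ → ℂ} (h : IsSol c U S) (h' : IsSol c U S') {y : ℂ} (hy : y ∈ U)
    (e : S y = S' y) : EqOn S S' U := by
  have key : ∀ k, ∀ z ∈ U, S z k = S' z k := by
    intro k
    induction k using Nat.strong_induction_on with
    | _ k ih =>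
      refine eqOn_of_hasDerivAt hU hc (f' := fun z => rhs c z (S z) k) (fun z hz => h z hz k)
        (fun z hz => ?_) hy (congrFun e k)
      have := h' z hz k
      match k, ih, this with
      | 0, _, this => exact this
      | 1, ih, this => simpa only [rhs, ih 0 one_pos z hz] using this
      | k + 2, ih, this => simpa only [rhs, ih (k + 1) (by omega) z hz] using this
  exact fun z hz => funext fun k => key k z hz

theorem exists_primitive {a : ℂ} {r : ℝ} {f : ℂ → ℂ} (hf : DifferentiableOn ℂ f (ball a r))
    (y v : ℂ) : ∃ g : ℂ → ℂ, g y = v ∧ ∀ z ∈ ball a r, HasDerivAt g (f z) z :=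
  hf.isExactOn_ball.with_val_at y v

/-- A disc avoiding `0` and `1` is simply connected, so the coordinates are obtained one after the
other as primitives with prescribed values. -/
theorem IsSol.exists {c : ℂ} {a : ℂ} {r : ℝ} (h0 : (0 : ℂ) ∉ ball a r) (h1 : (1 : ℂ) ∉ ball a r)
    (y : ℂ) (v : ℕ → ℂ) : ∃ S, IsSol c (ball a r) S ∧ S y = v := by
  have n0 : ∀ z ∈ ball a r, z ≠ 0 := fun z hz e => h0 (e ▸ hz)
  have n1 : ∀ z ∈ ball a r, 1 - z ≠ 0 := fun z hz e => h1 ((sub_eq_zero.1 e) ▸ hz)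
  obtain ⟨l, hly, hl⟩ := exists_primitive (a := a) (r := r) (f := fun z => 1 / z)
    (by fun_prop (disch := assumption)) y (v 0)
  have hld : DifferentiableOn ℂ l (ball a r) :=
    fun z hz => (hl z hz).differentiableAt.differentiableWithinAt
  obtain ⟨u, huy, hu⟩ := exists_primitive (a := a) (r := r)
    (f := fun z => Complex.exp (c * l z) / (1 - z) / z)
    (by fun_prop (disch := assumption)) y (v 1)
  have step : ∀ (k : ℕ) (f : {f : ℂ → ℂ // DifferentiableOn ℂ f (ball a r)}),
      ∃ g : {g : ℂ → ℂ // DifferentiableOn ℂ g (ball a r)},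
        g.1 y = v (k + 2) ∧ ∀ z ∈ ball a r, HasDerivAt g.1 (f.1 z / z) z := by
    intro k f
    obtain ⟨g, hgy, hg⟩ := exists_primitive (a := a) (r := r) (f := fun z => f.1 z / z)
      (f.2.div differentiableOn_id n0) y (v (k + 2))
    exact ⟨⟨g, fun z hz => (hg z hz).differentiableAt.differentiableWithinAt⟩, hgy, hg⟩
  choose next next_y next_deriv using step
  let w : ℕ → {f : ℂ → ℂ // DifferentiableOn ℂ f (ball a r)} := fun k =>
    Nat.rec ⟨u, fun z hz => (hu z hz).differentiableAt.differentiableWithinAt⟩ next k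
  let S : ℂ → ℕ → ℂ := fun z k => match k with
    | 0 => l z
    | k + 1 => (w k).1 z
  refine ⟨S, fun z hz k => ?_, funext fun k => ?_⟩
  · match k with
    | 0 => exact hl z hz
    | 1 => exact hu z hz
    | k + 2 => exact next_deriv k (w k) z hz
  · match k with
    | 0 => exact hly
    | 1 => exact huy
    | k + 2 => exact next_y k (w k)

/-- The affine symmetries of the differential system: translate `ℓ` by `a`, multiply the `u_k`
by `q` and add functions `h_k(ℓ)`. -/
def shift (q a : ℂ) (h : ℕ → ℂ → ℂ) (v : ℕ → ℂ) : ℕ → ℂ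
  | 0 => v 0 + a
  | k + 1 => q * v (k + 1) + h (k + 1) (v 0)

/-- The only nonlinear term `e^{cℓ}` is multiplied by `e^{ca} = q`, which matches the scaling of
`u₁`. The added `h_k(ℓ)` satisfies the homogeneous equations because `z · d/dz h_{k+1}(ℓ) = h_k(ℓ)`.
-/
theorem IsSol.shift {c q a : ℂ} {h : ℕ → ℂ → ℂ} (hq : Complex.exp (c * a) = q)
    (h0 : ∀ w, h 0 w = 0) (hh : ∀ k w, HasDerivAt (h (k + 1)) (h k w) w) {U : Set ℂ}
    {S : ℂ → ℕ → ℂ} (hS : IsSol c U S) :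
    IsSol c U (fun z => PolylogMonodromy.shift q a h (S z)) := by
  intro z hz k
  match k with
  | 0 => exact (hS z hz 0).add_const a
  | 1 =>
    refine (((hS z hz 1).const_mul q).add ((hh 0 _).comp z (hS z hz 0))).congr_deriv ?_
    simp only [rhs, PolylogMonodromy.shift, h0, ← hq, mul_add, Complex.exp_add]
    ring
  | k + 2 =>
    refine (((hS z hz (k + 2)).const_mul q).add ((hh (k + 1) _).comp z (hS z hz 0))).congr_deriv ?_
    simp only [rhs, PolylogMonodromy.shift]
    ring

/-! ### Transport of solutions along paths -/

/-- The radius of the largest disc around `x` that avoids `0` and `1`. -/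
def radius (x : PuncturedPlane) : ℝ := min ‖(x : ℂ)‖ ‖(x : ℂ) - 1‖

theorem radius_pos (x : PuncturedPlane) : 0 < radius x :=
  lt_min (norm_pos_iff.2 x.2.1) (norm_pos_iff.2 (sub_ne_zero.2 x.2.2))

theorem zero_notMem_ball (x : PuncturedPlane) : (0 : ℂ) ∉ ball (x : ℂ) (radius x) := by
  simp [radius]

theorem one_notMem_ball (x : PuncturedPlane) : (1 : ℂ) ∉ ball (x : ℂ) (radius x) := by
  simp [radius, dist_eq_norm, norm_sub_rev]

/-- The value at `y` of the solution with value `v` at `x`, on a disc that contains `x`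
and `y`. -/
def localTransport (c : ℂ) (x y : PuncturedPlane) (v : ℕ → ℂ) : ℕ → ℂ :=
  open Classical in
  if h : ∃ (S : ℂ → ℕ → ℂ) (i : PuncturedPlane), (x : ℂ) ∈ ball (i : ℂ) (radius i) ∧
    (y : ℂ) ∈ ball (i : ℂ) (radius i) ∧ IsSol c (ball (i : ℂ) (radius i)) S ∧ S x = v
  then h.choose y else v

/-- The chosen solution lives on some disc and `S` on the convex set `U`. Their intersection is
convex, hence connected, so they agree at `y`. In particular the choice of disc is immaterial. -/
theorem localTransport_eq {c : ℂ} {x y i : PuncturedPlane} {U : Set ℂ} {S : ℂ → ℕ → ℂ}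
    (hx : (x : ℂ) ∈ ball (i : ℂ) (radius i)) (hy : (y : ℂ) ∈ ball (i : ℂ) (radius i))
    (hU : IsOpen U) (hUc : Convex ℝ U) (hxU : (x : ℂ) ∈ U) (hyU : (y : ℂ) ∈ U)
    (hS : IsSol c U S) : localTransport c x y (S x) = S y := by
  obtain ⟨S₀, hS₀, e₀⟩ := IsSol.exists (c := c) (zero_notMem_ball i) (one_notMem_ball i) x (S x)
  have h : ∃ (S' : ℂ → ℕ → ℂ) (i : PuncturedPlane), (x : ℂ) ∈ ball (i : ℂ) (radius i) ∧
    (y : ℂ) ∈ ball (i : ℂ) (radius i) ∧ IsSol c (ball (i : ℂ) (radius i)) S' ∧ S' x = S x :=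
    ⟨S₀, i, hx, hy, hS₀, e₀⟩
  rw [localTransport, dif_pos h]
  obtain ⟨j, hjx, hjy, hj, e⟩ := h.choose_spec
  exact IsSol.eqOn (isOpen_ball.inter hU) ((convex_ball (j : ℂ) _).inter hUc).isPreconnected
    (hj.mono inter_subset_left) (hS.mono inter_subset_right) ⟨hjx, hxU⟩ e ⟨hjy, hyU⟩

theorem localTransport_eventually {c : ℂ} {x : PuncturedPlane} {U : Set ℂ} {S : ℂ → ℕ → ℂ}
    (hU : U ∈ 𝓝 (x : ℂ)) (hS : IsSol c U S) :
    ∀ᶠ y : PuncturedPlane in 𝓝 x, localTransport c x y (S x) = S y := by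
  obtain ⟨r, hr, hrU⟩ := Metric.mem_nhds_iff.1 hU
  have h1 : ∀ᶠ y : PuncturedPlane in 𝓝 x, (y : ℂ) ∈ ball (x : ℂ) r :=
    continuous_subtype_val.continuousAt.eventually (ball_mem_nhds _ hr)
  have h2 : ∀ᶠ y : PuncturedPlane in 𝓝 x, (y : ℂ) ∈ ball (x : ℂ) (radius x) :=
    continuous_subtype_val.continuousAt.eventually (ball_mem_nhds _ (radius_pos x))
  filter_upwards [h1, h2] with y hy hy'
  exact localTransport_eq (mem_ball_self (radius_pos x)) hy' isOpen_ball (convex_ball _ _)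
    (mem_ball_self hr) hy (hS.mono hrU)

/-- The function `s` along the path `p` comes locally from solutions of the system. -/
def IsFlat (c : ℂ) {x y : PuncturedPlane} (p : Path x y) (s : unitInterval → ℕ → ℂ) : Prop :=
  ∀ t, ∀ᶠ t' in 𝓝 t, localTransport c (p t) (p t') (s t) = s t'

theorem exists_solution_transport (c : ℂ) :
    ∃ P : ∀ x y : PuncturedPlane, Path.Homotopic.Quotient x y → (ℕ → ℂ) → (ℕ → ℂ),
      (∀ (x y : PuncturedPlane) (p : Path x y) (s : unitInterval → ℕ → ℂ), IsFlat c p s →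
          P x y (Path.Homotopic.Quotient.mk p) (s 0) = s 1) ∧
      (∀ (x y : PuncturedPlane) (p : Path x y) (v : ℕ → ℂ), ∃ s : unitInterval → ℕ → ℂ,
        s 0 = v ∧ IsFlat c p s) ∧
      ∀ (x y z : PuncturedPlane) (γ : Path.Homotopic.Quotient x y)
        (δ : Path.Homotopic.Quotient y z) (v : ℕ → ℂ),
        P x z (γ.trans δ) v = P y z δ (P x y γ v) := by
  refine exists_transport (fun x => (Subtype.val ⁻¹' ball (x : ℂ) (radius x)))
    (fun x => isOpen_ball.preimage continuous_subtype_val) (fun x => mem_ball_self (radius_pos x))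
    (localTransport c) ?_ ?_
  · intro x v
    obtain ⟨S, hS, rfl⟩ := IsSol.exists (c := c) (zero_notMem_ball x) (one_notMem_ball x) x v
    exact localTransport_eq (i := x) (mem_ball_self (radius_pos x)) (mem_ball_self (radius_pos x))
      isOpen_ball (convex_ball _ _) (mem_ball_self (radius_pos x)) (mem_ball_self (radius_pos x)) hS
  · intro i x hx y hy z hz v
    obtain ⟨S, hS, rfl⟩ := IsSol.exists (c := c) (zero_notMem_ball i) (one_notMem_ball i) x v
    rw [localTransport_eq hx hy isOpen_ball (convex_ball _ _) hx hy hS,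
      localTransport_eq hx hz isOpen_ball (convex_ball _ _) hx hz hS,
      localTransport_eq hy hz isOpen_ball (convex_ball _ _) hy hz hS]

/-- Transport of the values of solutions along homotopy classes of paths. -/
def transport (c : ℂ) {x y : PuncturedPlane} (γ : Path.Homotopic.Quotient x y) (v : ℕ → ℂ) :
    ℕ → ℂ :=
  (exists_solution_transport c).choose x y γ v

theorem IsFlat.transport_eq {c : ℂ} {x y : PuncturedPlane} {p : Path x y}
    {s : unitInterval → ℕ → ℂ} (h : IsFlat c p s) :
    transport c (Path.Homotopic.Quotient.mk p) (s 0) = s 1 :=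
  (exists_solution_transport c).choose_spec.1 x y p s h

theorem exists_isFlat (c : ℂ) {x y : PuncturedPlane} (p : Path x y) (v : ℕ → ℂ) :
    ∃ s : unitInterval → ℕ → ℂ, s 0 = v ∧ IsFlat c p s :=
  (exists_solution_transport c).choose_spec.2.1 x y p v

theorem transport_trans (c : ℂ) {x y z : PuncturedPlane} (γ : Path.Homotopic.Quotient x y)
    (δ : Path.Homotopic.Quotient y z) (v : ℕ → ℂ) :
    transport c (γ.trans δ) v = transport c δ (transport c γ v) :=
  (exists_solution_transport c).choose_spec.2.2 x y z γ δ v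

/-- A function along a path that is locally a solution composed with the path is flat. -/
theorem IsFlat.of_isSol {c : ℂ} {x y : PuncturedPlane} {p : Path x y} {s : unitInterval → ℕ → ℂ}
    (h : ∀ t, ∃ U ∈ 𝓝 (p t : ℂ), ∃ S, IsSol c U S ∧ S (p t) = s t ∧
      ∀ᶠ t' in 𝓝 t, S (p t') = s t') : IsFlat c p s := by
  intro t
  obtain ⟨U, hU, S, hS, e, he⟩ := h t
  have := p.continuous.continuousAt.eventually (localTransport_eventually hU hS)
  filter_upwards [this, he] with t' h1 h2
  rw [← e, h1, h2]

/-- Along a path inside an open set on which `S` is a solution, transport is given by `S`. -/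
theorem transport_of_isSol {c : ℂ} {x y : PuncturedPlane} {p : Path x y} {U : Set ℂ}
    (hU : IsOpen U) {S : ℂ → ℕ → ℂ} (hS : IsSol c U S) (hp : ∀ t, (p t : ℂ) ∈ U) :
    transport c (Path.Homotopic.Quotient.mk p) (S x) = S y := by
  have : IsFlat c p (fun t => S (p t)) :=
    IsFlat.of_isSol fun t => ⟨U, hU.mem_nhds (hp t), S, hS, rfl, .of_forall fun _ => rfl⟩
  simpa using this.transport_eq

theorem IsFlat.shift {c q a : ℂ} {h : ℕ → ℂ → ℂ} (hq : Complex.exp (c * a) = q)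
    (h0 : ∀ w, h 0 w = 0) (hh : ∀ k w, HasDerivAt (h (k + 1)) (h k w) w) {x y : PuncturedPlane}
    {p : Path x y} {s : unitInterval → ℕ → ℂ} (hs : IsFlat c p s) :
    IsFlat c p (fun t => PolylogMonodromy.shift q a h (s t)) := by
  refine IsFlat.of_isSol fun t => ?_
  obtain ⟨S, hS, e⟩ := IsSol.exists (c := c) (zero_notMem_ball (p t)) (one_notMem_ball (p t))
    (p t) (s t)
  have hU := ball_mem_nhds (p t : ℂ) (radius_pos (p t))
  refine ⟨_, hU, _, hS.shift hq h0 hh, by rw [e], ?_⟩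
  filter_upwards [hs t, p.continuous.continuousAt.eventually (localTransport_eventually hU hS)]
    with t' h1 h2
  rw [← h2, e, h1]

/-- Transport commutes with the symmetries of the system. -/
theorem transport_shift {c q a : ℂ} {h : ℕ → ℂ → ℂ} (hq : Complex.exp (c * a) = q)
    (h0 : ∀ w, h 0 w = 0) (hh : ∀ k w, HasDerivAt (h (k + 1)) (h k w) w) {x y : PuncturedPlane}
    (γ : Path.Homotopic.Quotient x y) (v : ℕ → ℂ) :
    transport c γ (shift q a h v) = shift q a h (transport c γ v) := by
  induction γ using Path.Homotopic.Quotient.ind with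
  | mk p =>
    obtain ⟨s, rfl, hs⟩ := exists_isFlat c p v
    rw [hs.transport_eq, (hs.shift hq h0 hh).transport_eq]

/-- A primitive of `1 / z` on a convex open set is a logarithm there if it is one at a point. -/
theorem exp_eq_of_hasDerivAt {U : Set ℂ} (hU : IsOpen U) (hc : IsPreconnected U) (h0 : (0 : ℂ) ∉ U)
    {l : ℂ → ℂ} (hl : ∀ z ∈ U, HasDerivAt l (1 / z) z) {y z : ℂ} (hy : y ∈ U) (hz : z ∈ U) :
    Complex.exp (l z) / z = Complex.exp (l y) / y := by
  have n0 : ∀ z ∈ U, z ≠ 0 := fun z hz e => h0 (e ▸ hz)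
  refine eqOn_of_hasDerivAt hU hc (f := fun z => Complex.exp (l z) / z)
    (g := fun _ => Complex.exp (l y) / y) (f' := fun _ => 0) (fun w hw => ?_)
    (fun w _ => hasDerivAt_const w _) hy rfl hz
  refine (((hl w hw).cexp).div (hasDerivAt_id w) (n0 w hw)).congr_deriv ?_
  have := n0 w hw
  simp only [id]
  field_simp
  ring

/-- The coordinate of index `0` of a transported value remains a logarithm of the end point. -/
theorem exp_transport_zero {c : ℂ} {x y : PuncturedPlane} (γ : Path.Homotopic.Quotient x y)
    {v : ℕ → ℂ} (hv : Complex.exp (v 0) = x) : Complex.exp (transport c γ v 0) = y := by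
  induction γ using Path.Homotopic.Quotient.ind with
  | mk p =>
    obtain ⟨s, rfl, hs⟩ := exists_isFlat c p v
    rw [hs.transport_eq]
    have hlc : IsLocallyConstant (fun t => Complex.exp (s t 0) / (p t : ℂ)) := by
      refine (IsLocallyConstant.iff_eventually_eq _).2 fun t => ?_
      obtain ⟨S, hS, e⟩ := IsSol.exists (c := c) (zero_notMem_ball (p t)) (one_notMem_ball (p t))
        (p t) (s t)
      have hU := ball_mem_nhds (p t : ℂ) (radius_pos (p t))
      have hm : ∀ᶠ t' in 𝓝 t, (p t' : ℂ) ∈ ball (p t : ℂ) (radius (p t)) :=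
        (continuous_subtype_val.comp p.continuous).continuousAt.eventually hU
      filter_upwards [hs t, hm,
        p.continuous.continuousAt.eventually (localTransport_eventually hU hS)] with t' h1 h2 h3
      rw [← h1, ← e, h3]
      exact exp_eq_of_hasDerivAt isOpen_ball (convex_ball _ _).isPreconnected (zero_notMem_ball _)
        (fun z hz => hS z hz 0) (mem_ball_self (radius_pos _)) h2
    have h := hlc.apply_eq_of_isPreconnected isPreconnected_univ (mem_univ 1) (mem_univ 0)
    rw [hv, p.source, p.target, div_self x.2.1, div_eq_one_iff_eq y.2.1] at h
    exact h

/-- Near a point of a path, a continuous logarithm along the path is given by a local primitive of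
`1 / z`. -/
theorem eventually_eq_log {x y : PuncturedPlane} {p : Path x y} {ℓ : unitInterval → ℂ}
    (hℓ : Continuous ℓ) (he : ∀ t, Complex.exp (ℓ t) = p t) {t : unitInterval} {U : Set ℂ}
    (hU : U ∈ 𝓝 (p t : ℂ)) {l : ℂ → ℂ} (hl : ∀ z ∈ U, HasDerivAt l (1 / z) z)
    (hlt : l (p t) = ℓ t) : ∀ᶠ t' in 𝓝 t, l (p t') = ℓ t' := by
  obtain ⟨r, hr, hrU⟩ := Metric.mem_nhds_iff.1 (inter_mem hU (ball_mem_nhds _ (radius_pos (p t))))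
  have hpc : ContinuousAt (fun t => (p t : ℂ)) t :=
    (continuous_subtype_val.comp p.continuous).continuousAt
  have hm : ∀ᶠ t' in 𝓝 t, (p t' : ℂ) ∈ ball (p t : ℂ) r := hpc.eventually (ball_mem_nhds _ hr)
  have hd : ContinuousAt (fun t' => (l (p t') - ℓ t').im) t :=
    Complex.continuous_im.continuousAt.comp
      (((hl _ (mem_of_mem_nhds hU)).continuousAt.comp_of_eq hpc rfl).sub hℓ.continuousAt)
  -- Two logarithms of the same number differ by a multiple of `2πi`; imaginary part of absolute
  -- value less than `π` makes the difference `0`.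
  have h1 : ∀ᶠ t' in 𝓝 t, (l (p t') - ℓ t').im ∈ Ioo (-Real.pi) Real.pi := by
    refine hd.eventually (Ioo_mem_nhds ?_ ?_) <;> simp [hlt, Real.pi_pos]
  filter_upwards [hm, h1] with t' h2 h3
  have h4 := exp_eq_of_hasDerivAt isOpen_ball (convex_ball _ _).isPreconnected
    (fun h => zero_notMem_ball _ (hrU h).2) (fun z hz => hl z (hrU hz).1) (mem_ball_self hr) h2
  rw [hlt, he, div_self (p t).2.1, div_eq_one_iff_eq (p t').2.1] at h4
  have h5 : Complex.exp (l (p t') - ℓ t') = 1 := by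
    rw [Complex.exp_sub, h4, he, div_self (p t').2.1]
  have h6 := Complex.log_exp h3.1 h3.2.le
  rw [h5, Complex.log_one] at h6
  exact (sub_eq_zero.1 h6.symm)

/-! ### The power series -/

/-- The Lerch series `Φ(k, z, c) = ∑ z ^ n / (n + c) ^ k`. -/
def lerch (c : ℂ) (k : ℕ) (z : ℂ) : ℂ := ∑' n : ℕ, z ^ n / ((n : ℂ) + c) ^ k

theorem deformedPolylog_eq (m : ℕ) (c z : ℂ) : deformedPolylog m c z = z * lerch c m z := by
  rw [deformedPolylog, lerch, ← tsum_mul_left]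
  refine tsum_congr fun n => ?_
  ring

theorem add_ne_zero_of_notMem {c : ℂ} (hc : ∀ k : ℕ, c ≠ -(k : ℂ)) (n : ℕ) : (n : ℂ) + c ≠ 0 :=
  fun h => hc n (eq_neg_of_add_eq_zero_right h)

theorem exists_inv_norm_le (c : ℂ) : ∃ C : ℝ, ∀ n : ℕ, ‖((n : ℂ) + c)⁻¹‖ ≤ C := by
  have h : Tendsto (fun n : ℕ => ‖((n : ℂ) + c)⁻¹‖) atTop (𝓝 0) := by
    have h1 : Tendsto (fun n : ℕ => ‖(n : ℂ) + c‖) atTop atTop := by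
      refine tendsto_atTop_mono (f := fun n : ℕ => (n : ℝ) - ‖c‖) (fun n => ?_)
        (tendsto_atTop_add_const_right _ _ tendsto_natCast_atTop_atTop)
      have := norm_sub_norm_le (n : ℂ) (-c)
      simpa using this
    simp only [norm_inv]
    exact h1.inv_tendsto_atTop
  obtain ⟨C, hC⟩ := h.bddAbove_range
  exact ⟨C, fun n => hC ⟨n, rfl⟩⟩

theorem norm_lerch_term_le {c : ℂ} {C : ℝ} (hC : ∀ n : ℕ, ‖((n : ℂ) + c)⁻¹‖ ≤ C) (k n : ℕ)
    {z : ℂ} {r : ℝ} (hz : ‖z‖ ≤ r) : ‖z ^ n / ((n : ℂ) + c) ^ k‖ ≤ r ^ n * C ^ k := by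
  rw [div_eq_mul_inv, norm_mul, norm_pow, ← inv_pow, norm_pow]
  have hr : 0 ≤ r := (norm_nonneg z).trans hz
  gcongr
  exact hC n

theorem summable_lerch (c : ℂ) (k : ℕ) {z : ℂ} (hz : ‖z‖ < 1) :
    Summable (fun n : ℕ => z ^ n / ((n : ℂ) + c) ^ k) := by
  obtain ⟨C, hC⟩ := exists_inv_norm_le c
  exact Summable.of_norm_bounded ((summable_geometric_of_lt_one (norm_nonneg z) hz).mul_right _)
    fun n => norm_lerch_term_le hC k n le_rfl

theorem lerch_zero (c : ℂ) {z : ℂ} (hz : ‖z‖ < 1) : lerch c 0 z = 1 / (1 - z) := by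
  simp [lerch, tsum_geometric_of_norm_lt_one hz]

/-- Termwise, `(n + c) z^n / (n+c)^{k+1} = z^n / (n+c)^k`; differentiation under the sum is
justified by a geometric majorant on a disc of radius between `‖z‖` and `1`. -/
theorem hasDerivAt_lerch {c : ℂ} (hc : ∀ k : ℕ, c ≠ -(k : ℂ)) (k : ℕ) {z : ℂ} (hz : ‖z‖ < 1) :
    ∃ d, HasDerivAt (lerch c (k + 1)) d z ∧ z * d + c * lerch c (k + 1) z = lerch c k z := by
  obtain ⟨C, hC⟩ := exists_inv_norm_le c
  obtain ⟨r, hzr, hr⟩ := exists_between hz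
  have hr0 : 0 ≤ r := (norm_nonneg z).trans hzr.le
  have hu : Summable (fun n : ℕ => r ^ n * C ^ (k + 1)) :=
    (summable_geometric_of_lt_one hr0 hr).mul_right _
  have hzb : z ∈ ball (0 : ℂ) r := by simpa using hzr
  have hle : ∀ (n : ℕ) (w : ℂ), w ∈ ball (0 : ℂ) r →
      ‖w ^ n / ((n : ℂ) + c) ^ (k + 1)‖ ≤ r ^ n * C ^ (k + 1) := fun n w hw =>
    norm_lerch_term_le hC (k + 1) n (by simpa using (mem_ball_zero_iff.1 hw).le)
  have hdiff : ∀ n : ℕ, DifferentiableOn ℂ (fun w : ℂ => w ^ n / ((n : ℂ) + c) ^ (k + 1))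
      (ball 0 r) := fun n => by fun_prop
  have hs := Complex.hasSum_deriv_of_summable_norm hu hdiff isOpen_ball hle hzb
  have hd := (Complex.differentiableOn_tsum_of_summable_norm hu hdiff isOpen_ball hle).differentiableAt
    (isOpen_ball.mem_nhds hzb)
  refine ⟨_, hd.hasDerivAt, ?_⟩
  have h1 := (hs.mul_left z).add ((summable_lerch c (k + 1) hz).hasSum.mul_left c)
  refine h1.unique ?_
  refine (summable_lerch c k hz).hasSum.congr_fun fun n => ?_
  have hn := add_ne_zero_of_notMem hc n
  have hder : deriv (fun w : ℂ => w ^ n / ((n : ℂ) + c) ^ (k + 1)) z =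
      n * z ^ (n - 1) / ((n : ℂ) + c) ^ (k + 1) :=
    ((hasDerivAt_pow n z).div_const _).deriv
  have hz' : z * (n * z ^ (n - 1)) = n * z ^ n := by
    cases n with
    | zero => simp
    | succ n => simp only [Nat.add_sub_cancel]; ring
  rw [hder, mul_div_assoc', hz', pow_succ]
  field_simp

/-- The solution `u_k = ∑ exp ((n + c) w) / (n + c) ^ k` in terms of the logarithm `w`,
for `Re w < 0`. -/
def seriesSol (c w : ℂ) : ℕ → ℂ
  | 0 => w
  | k + 1 => Complex.exp (c * w) * lerch c (k + 1) (Complex.exp w)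

theorem norm_exp_lt_one {w : ℂ} (hw : w.re < 0) : ‖Complex.exp w‖ < 1 := by
  rw [Complex.norm_exp]
  simpa using hw

theorem re_neg_of_norm_exp {w : ℂ} (hw : ‖Complex.exp w‖ < 1) : w.re < 0 := by
  rwa [Complex.norm_exp, Real.exp_lt_one_iff] at hw

theorem hasDerivAt_seriesSol {c : ℂ} (hc : ∀ k : ℕ, c ≠ -(k : ℂ)) (k : ℕ) {w : ℂ}
    (hw : w.re < 0) : HasDerivAt (fun w => seriesSol c w (k + 1))
      (Complex.exp (c * w) * lerch c k (Complex.exp w)) w := by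
  obtain ⟨d, hd, e⟩ := hasDerivAt_lerch hc k (norm_exp_lt_one hw)
  have h1 : HasDerivAt (fun w => Complex.exp (c * w)) (Complex.exp (c * w) * (c * 1)) w :=
    ((hasDerivAt_id w).const_mul c).cexp
  refine (h1.mul (hd.comp w (Complex.hasDerivAt_exp w))).congr_deriv ?_
  rw [← e]
  simp only [Function.comp]
  ring

theorem isSol_seriesSol {c : ℂ} (hc : ∀ k : ℕ, c ≠ -(k : ℂ)) {U : Set ℂ} {l : ℂ → ℂ}
    (hl : ∀ z ∈ U, HasDerivAt l (1 / z) z) (he : ∀ z ∈ U, Complex.exp (l z) = z)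
    (hU : ∀ z ∈ U, ‖z‖ < 1) : IsSol c U (fun z => seriesSol c (l z)) := by
  intro z hz k
  have hre : (l z).re < 0 := re_neg_of_norm_exp (by rw [he z hz]; exact hU z hz)
  match k with
  | 0 => exact hl z hz
  | 1 =>
    refine ((hasDerivAt_seriesSol hc 0 hre).comp z (hl z hz)).congr_deriv ?_
    rw [lerch_zero _ (norm_exp_lt_one hre), he z hz]
    simp only [rhs, seriesSol]
    ring
  | k + 2 =>
    refine ((hasDerivAt_seriesSol hc (k + 1) hre).comp z (hl z hz)).congr_deriv ?_
    simp only [rhs, seriesSol]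
    ring

/-! ### The initial value at the base point -/

/-- The branch of the logarithm that is real up to `π i` on the negative real axis. -/
def negLog (z : ℂ) : ℂ := Complex.log (-z) + Real.pi * Complex.I

theorem coe_base : (base : ℂ) = -1 := rfl

theorem radius_base : radius base = 1 := by
  simp only [radius, coe_base]
  norm_num

theorem neg_mem_slitPlane {z : ℂ} (hz : z ∈ ball (-1 : ℂ) 1) : -z ∈ Complex.slitPlane := by
  refine Complex.mem_slitPlane_of_norm_lt_one (z := -z - 1) ?_ |> fun h => by simpa using h
  rw [mem_ball, dist_eq_norm] at hz
  rw [← norm_neg]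
  convert! hz using 2
  ring

theorem hasDerivAt_negLog {z : ℂ} (hz : z ∈ ball (-1 : ℂ) 1) : HasDerivAt negLog (1 / z) z := by
  refine (((hasDerivAt_neg z).clog (neg_mem_slitPlane hz)).add_const _).congr_deriv ?_
  rw [neg_div_neg_eq]

theorem exp_negLog {z : ℂ} (hz : z ≠ 0) : Complex.exp (negLog z) = z := by
  rw [negLog, Complex.exp_add, Complex.exp_log (neg_ne_zero.2 hz), Complex.exp_pi_mul_I]
  ring

theorem ne_zero_of_mem_ball {z : ℂ} (hz : z ∈ ball (-1 : ℂ) 1) : z ≠ 0 := by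
  rintro rfl
  simp at hz

/-- The solution around the base point that is given by the power series inside the unit disc. -/
def baseSol (c : ℂ) : ℂ → ℕ → ℂ :=
  (IsSol.exists (c := c) (zero_notMem_ball base) (one_notMem_ball base) (-1 / 2)
    (seriesSol c (negLog (-1 / 2)))).choose

theorem isSol_baseSol (c : ℂ) : IsSol c (ball (-1) 1) (baseSol c) := by
  have := (IsSol.exists (c := c) (zero_notMem_ball base) (one_notMem_ball base) (-1 / 2)
    (seriesSol c (negLog (-1 / 2)))).choose_spec.1
  change IsSol c (ball base (radius base)) (baseSol c) at this
  rwa [radius_base, coe_base] at this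

theorem baseSol_neg_half (c : ℂ) : baseSol c (-1 / 2) = seriesSol c (negLog (-1 / 2)) :=
  (IsSol.exists (c := c) (zero_notMem_ball base) (one_notMem_ball base) (-1 / 2)
    (seriesSol c (negLog (-1 / 2)))).choose_spec.2

theorem neg_half_mem : (-1 / 2 : ℂ) ∈ ball (-1 : ℂ) 1 := by
  rw [mem_ball, dist_eq_norm]
  norm_num

/-- The base point is on the circle of convergence, so the series cannot be evaluated there. Instead
`baseSol` is matched with it at `-1/2`, and uniqueness spreads the equality over the intersection of
the two discs. -/
theorem baseSol_eq {c : ℂ} (hc : ∀ k : ℕ, c ≠ -(k : ℂ)) {z : ℂ} (hz : z ∈ ball (-1 : ℂ) 1)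
    (hz1 : ‖z‖ < 1) : baseSol c z = seriesSol c (negLog z) := by
  have h : IsSol c (ball (-1) 1 ∩ ball 0 1) (fun z => seriesSol c (negLog z)) :=
    isSol_seriesSol hc (fun z hz => hasDerivAt_negLog hz.1)
      (fun z hz => exp_negLog (ne_zero_of_mem_ball hz.1)) (fun z hz => by simpa using hz.2)
  refine IsSol.eqOn (isOpen_ball.inter isOpen_ball)
    ((convex_ball _ _).inter (convex_ball _ _)).isPreconnected
    ((isSol_baseSol c).mono inter_subset_left) h (y := -1 / 2) ⟨neg_half_mem, ?_⟩
    (baseSol_neg_half c) ⟨hz, by simpa using hz1⟩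
  rw [mem_ball, dist_eq_norm]
  norm_num

theorem baseSol_zero (c : ℂ) {z : ℂ} (hz : z ∈ ball (-1 : ℂ) 1) : baseSol c z 0 = negLog z :=
  eqOn_of_hasDerivAt isOpen_ball (convex_ball _ _).isPreconnected
    (fun z hz => isSol_baseSol c z hz 0) (fun _ hz => hasDerivAt_negLog hz) neg_half_mem
    (congrFun (baseSol_neg_half c) 0) hz

/-- The initial value at the base point. -/
def initial (c : ℂ) : ℕ → ℂ := baseSol c (-1)

theorem initial_zero (c : ℂ) : initial c 0 = Real.pi * Complex.I := by
  rw [initial, baseSol_zero c (mem_ball_self one_pos), negLog]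
  simp

/-! ### Transport along paths in the closed unit disc -/

/-- The Lerch factor sees only `e^w`, which has period `2πi`; the prefactor `e^{cw}` supplies the
scaling. -/
theorem shift_seriesSol {c w : ℂ} {n : ℤ} {a : ℂ} (ha : a = n * (2 * Real.pi * Complex.I)) :
    shift (Complex.exp (c * a)) a (fun _ _ => 0) (seriesSol c w) = seriesSol c (w + a) := by
  have h : Complex.exp (w + a) = Complex.exp w := by
    rw [Complex.exp_add, ha, Complex.exp_int_mul_two_pi_mul_I, mul_one]
  funext k
  cases k with
  | zero => rfl
  | succ k =>
    simp only [shift, seriesSol, h, mul_add, Complex.exp_add]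
    ring

open Classical in
/-- The extension of the solution given by the power series to the logarithms of `-1`. -/
def extendedSol (c w : ℂ) : ℕ → ℂ :=
  if w.re < 0 then seriesSol c w
  else shift (Complex.exp (c * (w - Real.pi * Complex.I))) (w - Real.pi * Complex.I)
    (fun _ _ => 0) (initial c)

theorem IsSol.shift_zero {c a : ℂ} {U : Set ℂ} {S : ℂ → ℕ → ℂ} (hS : IsSol c U S) :
    IsSol c U (fun z => PolylogMonodromy.shift (Complex.exp (c * a)) a (fun _ _ => 0) (S z)) :=
  hS.shift rfl (fun _ => rfl) (fun _ _ => hasDerivAt_const _ _)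

/-- Inside the disc the tuple is the power series in the current logarithm. At `-1` it is `baseSol`,
shifted by the multiple of `2πi` that the logarithm has gained. Both descriptions agree near `-1` by
`baseSol_eq` and `shift_seriesSol`, so the continuous logarithm `ℓ` alone determines the transported
value. -/
theorem transport_initial {c : ℂ} (hc : ∀ k : ℕ, c ≠ -(k : ℂ)) {y : PuncturedPlane}
    {p : Path base y} {ℓ : unitInterval → ℂ} (hℓ : Continuous ℓ) (hℓ0 : ℓ 0 = Real.pi * Complex.I)
    (he : ∀ t, Complex.exp (ℓ t) = p t) (hp : ∀ t, ‖(p t : ℂ)‖ < 1 ∨ (p t : ℂ) = -1) :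
    transport c (Path.Homotopic.Quotient.mk p) (initial c) = extendedSol c (ℓ 1) := by
  have hflat : IsFlat c p (fun t => extendedSol c (ℓ t)) := by
    refine IsFlat.of_isSol fun t => ?_
    have hpc : ContinuousAt (fun t => (p t : ℂ)) t :=
      (continuous_subtype_val.comp p.continuous).continuousAt
    rcases hp t with h1 | h1
    · obtain ⟨S, hS, e⟩ := IsSol.exists (c := c) (zero_notMem_ball (p t)) (one_notMem_ball (p t))
        (p t) (seriesSol c (ℓ t))
      have hV : ball (p t : ℂ) (radius (p t)) ∩ ball 0 1 ∈ 𝓝 (p t : ℂ) :=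
        inter_mem (ball_mem_nhds _ (radius_pos _)) (isOpen_ball.mem_nhds (by simpa using h1))
      have hl : ∀ z ∈ ball (p t : ℂ) (radius (p t)) ∩ ball 0 1,
          HasDerivAt (fun z => S z 0) (1 / z) z := fun z hz => hS z hz.1 0
      have hlt : S (p t) 0 = ℓ t := congrFun e 0
      have hexp : ∀ z ∈ ball (p t : ℂ) (radius (p t)), Complex.exp (S z 0) = z := by
        intro z hz
        have := exp_eq_of_hasDerivAt isOpen_ball (convex_ball _ _).isPreconnected
          (zero_notMem_ball _) (fun z hz => hS z hz 0) (mem_ball_self (radius_pos (p t))) hz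
        rw [hlt, he, div_self (p t).2.1, div_eq_one_iff_eq] at this
        · exact this
        · exact fun h => zero_notMem_ball (p t) (h ▸ hz)
      have hre : ∀ t', ‖(p t' : ℂ)‖ < 1 → (ℓ t').re < 0 := fun t' h =>
        re_neg_of_norm_exp (by rwa [he])
      refine ⟨_, hV, fun z => seriesSol c (S z 0), isSol_seriesSol hc hl
        (fun z hz => hexp z hz.1) (fun z hz => by simpa using hz.2), ?_, ?_⟩
      · simp only [extendedSol]
        rw [hlt, if_pos (hre t h1)]
      · filter_upwards [eventually_eq_log hℓ he hV hl hlt, hpc.eventually hV] with t' h2 h3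
        simp only [extendedSol]
        rw [h2, if_pos (hre t' (by simpa using h3.2))]
    · have hV : ball (-1 : ℂ) 1 ∈ 𝓝 (p t : ℂ) := by rw [h1]; exact ball_mem_nhds _ one_pos
      obtain ⟨n, hn⟩ : ∃ n : ℤ, ℓ t = Real.pi * Complex.I + n * (2 * Real.pi * Complex.I) :=
        Complex.exp_eq_exp_iff_exists_int.1 (by rw [he, h1, Complex.exp_pi_mul_I])
      have hnre : ∀ t', (p t' : ℂ) = -1 → ¬ (ℓ t').re < 0 := fun t' h h' => by
        have := norm_exp_lt_one h'
        rw [he, h] at this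
        simp at this
      have hlt : negLog (p t) + (ℓ t - Real.pi * Complex.I) = ℓ t := by
        rw [h1, negLog]; simp
      have hlog : ∀ᶠ t' in 𝓝 t, negLog (p t') + (ℓ t - Real.pi * Complex.I) = ℓ t' :=
        eventually_eq_log hℓ he hV (l := fun z => negLog z + (ℓ t - Real.pi * Complex.I))
          (fun z hz => (hasDerivAt_negLog hz).add_const _) hlt
      refine ⟨_, hV, _, (isSol_baseSol c).shift_zero (a := ℓ t - Real.pi * Complex.I), ?_, ?_⟩
      · simp only [extendedSol]
        rw [if_neg (hnre t h1), h1, initial]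
      · filter_upwards [hlog, hpc.eventually hV] with t' h2 h3
        simp only [extendedSol]
        rcases hp t' with h4 | h4
        · rw [if_pos (re_neg_of_norm_exp (by rwa [he])), baseSol_eq hc h3 h4,
            shift_seriesSol (n := n) (by rw [hn]; ring), h2]
        · rw [if_neg (hnre t' h4), h4, initial]
          have : ℓ t = ℓ t' := by rw [← h2, h4, negLog]; simp
          rw [this]
  -- At time `0` the logarithm is `πi`, where `extendedSol` is the shift by `0` of `initial c`, that
  -- is, `initial c` itself.
  have := hflat.transport_eq
  simp only [hℓ0, extendedSol] at this
  rw [if_neg (by simp)] at this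
  rw [← extendedSol] at this
  convert this using 2
  funext k
  cases k <;> simp [shift]

/-! ### Paths in convex sets -/

/-- The straight-line homotopy stays in `S`, hence avoids `0` and `1`. -/
theorem homotopic_of_convex {S : Set ℂ} (hS : Convex ℝ S) (h0 : (0 : ℂ) ∉ S) (h1 : (1 : ℂ) ∉ S)
    {x y : PuncturedPlane} {p q : Path x y} (hp : ∀ t, (p t : ℂ) ∈ S) (hq : ∀ t, (q t : ℂ) ∈ S) :
    p.Homotopic q := by
  have hm : ∀ st : unitInterval × unitInterval,
      ((1 - st.1 : ℝ) : ℂ) * (p st.2 : ℂ) + ((st.1 : ℝ) : ℂ) * (q st.2 : ℂ) ∈ S := fun st =>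
    by simpa using hS (hp st.2) (hq st.2) (sub_nonneg.2 st.1.2.2) st.1.2.1 (by ring)
  have hcp : Continuous fun t => (p t : ℂ) := continuous_subtype_val.comp p.continuous
  have hcq : Continuous fun t => (q t : ℂ) := continuous_subtype_val.comp q.continuous
  refine ⟨⟨⟨⟨fun st => ⟨_, fun e => h0 (e ▸ hm st), fun e => h1 (e ▸ hm st)⟩, ?_⟩, ?_, ?_⟩, ?_⟩⟩
  · refine Continuous.subtype_mk ?_ _
    fun_prop
  · intro t
    apply Subtype.ext
    simp
  · intro t
    apply Subtype.ext
    simp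
  · intro s t ht
    apply Subtype.ext
    rcases ht with rfl | rfl
    · simp [← add_mul]
    · simp [← add_mul]

theorem exists_line {x y : PuncturedPlane}
    (h : ∀ t ∈ Icc (0 : ℝ) 1, (1 - t : ℂ) * x + t * y ≠ 0 ∧ (1 - t : ℂ) * x + t * y ≠ 1) :
    ∃ p : Path x y, ∀ t : unitInterval, (p t : ℂ) = (1 - ((t : ℝ) : ℂ)) * x + ((t : ℝ) : ℂ) * y := by
  refine ⟨⟨⟨fun t => ⟨_, h t t.2⟩, ?_⟩, ?_, ?_⟩, fun t => rfl⟩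
  · refine Continuous.subtype_mk ?_ _
    fun_prop
  · apply Subtype.ext
    simp
  · apply Subtype.ext
    simp

theorem exists_line_of_convex {S : Set ℂ} (hS : Convex ℝ S) (h0 : (0 : ℂ) ∉ S) (h1 : (1 : ℂ) ∉ S)
    {x y : PuncturedPlane} (hx : (x : ℂ) ∈ S) (hy : (y : ℂ) ∈ S) :
    ∃ p : Path x y,
      (∀ t : unitInterval, (p t : ℂ) = (1 - ((t : ℝ) : ℂ)) * x + ((t : ℝ) : ℂ) * y) ∧
      ∀ t, (p t : ℂ) ∈ S := by
  have hm : ∀ t ∈ Icc (0 : ℝ) 1, (1 - t : ℂ) * x + t * y ∈ S := fun t ht => by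
    have := hS hx hy (sub_nonneg.2 ht.2) ht.1 (by ring)
    simpa using this
  obtain ⟨p, hp⟩ := exists_line (x := x) (y := y)
    fun t ht => ⟨fun e => h0 (e ▸ hm t ht), fun e => h1 (e ▸ hm t ht)⟩
  exact ⟨p, hp, fun t => by rw [hp]; exact hm t t.2⟩

/-- The open upper half plane together with the base point. -/
def upperSet : Set ℂ := {z | 0 < z.im ∨ z = -1}

/-- Only one boundary point is added to an open half plane: every proper convex combination with a
point of the half plane has positive imaginary part. -/
theorem convex_upperSet : Convex ℝ upperSet := by
  intro z hz w hw a b ha hb hab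
  rcases hz with hz | rfl <;> rcases hw with hw | rfl
  · left
    simp only [Complex.add_im, Complex.real_smul, Complex.im_ofReal_mul]
    rcases ha.eq_or_lt with rfl | ha
    · have : b = 1 := by linarith
      subst this
      linarith
    · nlinarith [mul_pos ha hz, mul_nonneg hb hw.le]
  · rcases ha.eq_or_lt with rfl | ha
    · right
      have : b = 1 := by linarith
      subst this
      simp
    · left
      simp only [Complex.add_im, Complex.real_smul, Complex.im_ofReal_mul]
      have := mul_pos ha hz
      simpa using this
  · rcases hb.eq_or_lt with rfl | hb
    · right
      have : a = 1 := by linarith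
      subst this
      simp
    · left
      simp only [Complex.add_im, Complex.real_smul, Complex.im_ofReal_mul]
      have := mul_pos hb hw
      simpa using this
  · right
    rw [← add_smul, hab, one_smul]

theorem zero_notMem_upperSet : (0 : ℂ) ∉ upperSet := by simp [upperSet]

theorem one_notMem_upperSet : (1 : ℂ) ∉ upperSet := by
  simp only [upperSet, mem_ofPred_eq, Complex.one_im, lt_irrefl, false_or]
  norm_num

/-- The straight line from the base point to a point of the upper half plane. -/
theorem exists_line_base {z : PuncturedPlane} (hz : 0 < (z : ℂ).im) :
    ∃ p : Path base z,
      (∀ t : unitInterval, (p t : ℂ) = (1 - ((t : ℝ) : ℂ)) * (-1) + ((t : ℝ) : ℂ) * z) ∧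
      (∀ t, (p t : ℂ) ∈ upperSet) ∧ ∀ t : unitInterval, 0 < t → 0 < (p t : ℂ).im := by
  obtain ⟨p, hp, hpS⟩ := exists_line_of_convex convex_upperSet zero_notMem_upperSet
    one_notMem_upperSet (x := base) (y := z) (.inr rfl) (.inl hz)
  refine ⟨p, hp, hpS, fun t ht => ?_⟩
  rw [hp, coe_base]
  have h : 0 < (t : ℝ) := ht
  simpa using mul_pos h hz

/-! ### The identity theorem on the universal cover -/

/-- Two functions on the universal cover agree near the class `δ`. -/
def AgreeNear (F G : UCover → ℂ) {x : PuncturedPlane} (δ : Path.Homotopic.Quotient base x) : Prop :=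
  ∃ r > 0, ∀ (w : PuncturedPlane) (p : Path x w), (∀ t, (p t : ℂ) ∈ ball (x : ℂ) r) →
    F ⟨w, δ.trans (Path.Homotopic.Quotient.mk p)⟩ = G ⟨w, δ.trans (Path.Homotopic.Quotient.mk p)⟩

theorem trans_assoc {x y z w : PuncturedPlane} (γ : Path.Homotopic.Quotient x y)
    (δ : Path.Homotopic.Quotient y z) (ε : Path.Homotopic.Quotient z w) :
    (γ.trans δ).trans ε = γ.trans (δ.trans ε) := by
  induction γ using Path.Homotopic.Quotient.ind
  induction δ using Path.Homotopic.Quotient.ind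
  induction ε using Path.Homotopic.Quotient.ind
  simp only [← Path.Homotopic.Quotient.mk_trans]
  exact Path.Homotopic.Quotient.eq.2 ⟨Path.Homotopy.transAssoc _ _ _⟩

theorem trans_refl {x y : PuncturedPlane} (γ : Path.Homotopic.Quotient x y) :
    γ.trans (Path.Homotopic.Quotient.refl y) = γ := by
  induction γ using Path.Homotopic.Quotient.ind
  rw [← Path.Homotopic.Quotient.mk_refl, ← Path.Homotopic.Quotient.mk_trans]
  exact Path.Homotopic.Quotient.eq.2 ⟨Path.Homotopy.transRefl _⟩

theorem refl_trans {x y : PuncturedPlane} (γ : Path.Homotopic.Quotient x y) :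
    (Path.Homotopic.Quotient.refl x).trans γ = γ := by
  induction γ using Path.Homotopic.Quotient.ind
  rw [← Path.Homotopic.Quotient.mk_refl, ← Path.Homotopic.Quotient.mk_trans]
  exact Path.Homotopic.Quotient.eq.2 ⟨Path.Homotopy.reflTrans _⟩

theorem eqOn_ball_of_eventuallyEq {a y : ℂ} {r : ℝ} {g k : ℂ → ℂ}
    (hg : DifferentiableOn ℂ g (ball a r)) (hk : DifferentiableOn ℂ k (ball a r))
    (hy : y ∈ ball a r) (h : g =ᶠ[𝓝 y] k) : EqOn g k (ball a r) :=
  (hg.analyticOnNhd isOpen_ball).eqOn_of_preconnected_of_eventuallyEq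
    (hk.analyticOnNhd isOpen_ball) (convex_ball a r).isPreconnected hy h

/-- The right-hand side involves neither `y` nor `p`. Thus agreement near one point reached inside
the ball is equivalent to agreement near any other, which is the local step of continuation along a
path. -/
theorem agreeNear_trans_iff {F G : UCover → ℂ} {x y : PuncturedPlane}
    (δ : Path.Homotopic.Quotient base x) {r : ℝ} (hr : r ≤ radius x) {g k : ℂ → ℂ}
    (hg : DifferentiableOn ℂ g (ball (x : ℂ) r)) (hk : DifferentiableOn ℂ k (ball (x : ℂ) r))
    (hF : ∀ (w : PuncturedPlane) (p : Path x w), (∀ t, (p t : ℂ) ∈ ball (x : ℂ) r) →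
      F ⟨w, δ.trans (Path.Homotopic.Quotient.mk p)⟩ = g w)
    (hG : ∀ (w : PuncturedPlane) (p : Path x w), (∀ t, (p t : ℂ) ∈ ball (x : ℂ) r) →
      G ⟨w, δ.trans (Path.Homotopic.Quotient.mk p)⟩ = k w)
    {p : Path x y} (hp : ∀ t, (p t : ℂ) ∈ ball (x : ℂ) r) :
    AgreeNear F G (δ.trans (Path.Homotopic.Quotient.mk p)) ↔ EqOn g k (ball (x : ℂ) r) := by
  have hy : (y : ℂ) ∈ ball (x : ℂ) r := by simpa using hp 1
  have htr : ∀ (w : PuncturedPlane) (q : Path y w), (∀ t, (q t : ℂ) ∈ ball (x : ℂ) r) →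
      ∀ t, ((p.trans q) t : ℂ) ∈ ball (x : ℂ) r := by
    intro w q hq t
    have := mem_range_self (f := p.trans q) t
    rw [Path.trans_range] at this
    rcases this with ⟨s, hs⟩ | ⟨s, hs⟩
    · rw [← hs]; exact hp s
    · rw [← hs]; exact hq s
  constructor
  · rintro ⟨r', hr', h⟩
    refine eqOn_ball_of_eventuallyEq hg hk hy ?_
    obtain ⟨e, he, heb⟩ := Metric.mem_nhds_iff.1
      (inter_mem (isOpen_ball.mem_nhds hy) (ball_mem_nhds (y : ℂ) hr'))
    filter_upwards [ball_mem_nhds (y : ℂ) he] with w hw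
    have h0 : (0 : ℂ) ∉ ball (y : ℂ) e :=
      fun h => zero_notMem_ball x (ball_subset_ball hr (heb h).1)
    have h1 : (1 : ℂ) ∉ ball (y : ℂ) e :=
      fun h => one_notMem_ball x (ball_subset_ball hr (heb h).1)
    let w' : PuncturedPlane := ⟨w, fun h => h0 (h ▸ hw), fun h => h1 (h ▸ hw)⟩
    obtain ⟨q, -, hq⟩ := exists_line_of_convex (convex_ball (y : ℂ) e) h0 h1 (x := y) (y := w')
      (mem_ball_self he) hw
    have h2 := h w' q fun t => (heb (hq t)).2
    rw [trans_assoc, ← Path.Homotopic.Quotient.mk_trans,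
      hF _ _ (htr _ q fun t => (heb (hq t)).1), hG _ _ (htr _ q fun t => (heb (hq t)).1)] at h2
    exact h2
  · intro h
    obtain ⟨e, he, heb⟩ := Metric.mem_nhds_iff.1 (isOpen_ball.mem_nhds hy)
    refine ⟨e, he, fun w q hq => ?_⟩
    rw [trans_assoc, ← Path.Homotopic.Quotient.mk_trans,
      hF _ _ (htr _ q fun t => heb (hq t)), hG _ _ (htr _ q fun t => heb (hq t))]
    exact h (heb (by simpa using hq 1))

theorem exists_local_pair {F G : UCover → ℂ} (hF : IsHolomorphic F) (hG : IsHolomorphic G)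
    {x : PuncturedPlane} (δ : Path.Homotopic.Quotient base x) :
    ∃ r, 0 < r ∧ r ≤ radius x ∧ ∃ g k : ℂ → ℂ, DifferentiableOn ℂ g (ball (x : ℂ) r) ∧
      DifferentiableOn ℂ k (ball (x : ℂ) r) ∧
      (∀ (w : PuncturedPlane) (p : Path x w), (∀ t, (p t : ℂ) ∈ ball (x : ℂ) r) →
        F ⟨w, δ.trans (Path.Homotopic.Quotient.mk p)⟩ = g w) ∧
      (∀ (w : PuncturedPlane) (p : Path x w), (∀ t, (p t : ℂ) ∈ ball (x : ℂ) r) →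
        G ⟨w, δ.trans (Path.Homotopic.Quotient.mk p)⟩ = k w) := by
  obtain ⟨r₁, hr₁, g, hg, hFg⟩ := hF x δ
  obtain ⟨r₂, hr₂, k, hk, hGk⟩ := hG x δ
  refine ⟨min (min r₁ r₂) (radius x), lt_min (lt_min hr₁ hr₂) (radius_pos x), min_le_right _ _,
    g, k, ?_, ?_, ?_, ?_⟩
  · exact hg.mono (ball_subset_ball ((min_le_left _ _).trans (min_le_left _ _)))
  · exact hk.mono (ball_subset_ball ((min_le_left _ _).trans (min_le_right _ _)))
  · exact fun w p hp => hFg w p fun t =>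
      ball_subset_ball ((min_le_left _ _).trans (min_le_left _ _)) (hp t)
  · exact fun w p hp => hGk w p fun t =>
      ball_subset_ball ((min_le_left _ _).trans (min_le_right _ _)) (hp t)

/-- Let `δ t` be the class of the initial segment of `p` up to time `t`. Agreement near `δ t` is
locally constant in `t` by `agreeNear_trans_iff`, hence constant on the unit interval. -/
theorem agreeNear_of_agreeNear_refl {F G : UCover → ℂ} (hF : IsHolomorphic F)
    (hG : IsHolomorphic G) (h : AgreeNear F G (Path.Homotopic.Quotient.refl base))
    {z : PuncturedPlane} (p : Path base z) : AgreeNear F G (Path.Homotopic.Quotient.mk p) := by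
  let δ : ∀ t, Path.Homotopic.Quotient base (p t) := fun t =>
    Path.Homotopic.Quotient.mk ((p.subpath 0 t).cast p.source.symm rfl)
  have hδ : ∀ t t', δ t' = (δ t).trans (Path.Homotopic.Quotient.mk (p.subpath t t')) := by
    intro t t'
    refine (Path.Homotopic.Quotient.eq.2 ?_).symm
    have := Path.Homotopic.pathCast ⟨Path.Homotopy.subpathTransSubpath p 0 t t'⟩
      p.source.symm rfl
    exact this
  have hlc : IsLocallyConstant (fun t => AgreeNear F G (δ t)) := by
    refine (IsLocallyConstant.iff_eventually_eq _).2 fun t => ?_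
    obtain ⟨r, hr, hrx, g, k, hg, hk, hFg, hGk⟩ := exists_local_pair hF hG (δ t)
    have hpc : Continuous fun t => (p t : ℂ) := continuous_subtype_val.comp p.continuous
    obtain ⟨e, he, heb⟩ := Metric.mem_nhds_iff.1
      (hpc.continuousAt.preimage_mem_nhds (ball_mem_nhds (p t : ℂ) hr))
    have hsub : ∀ t' ∈ ball t e, ∀ s, (p.subpath t t' s : ℂ) ∈ ball (p t : ℂ) r := by
      intro t' ht' s
      have hs := mem_range_self (f := p.subpath t t') s
      rw [Path.range_subpath] at hs
      obtain ⟨u, hu, hus⟩ := hs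
      rw [← hus]
      refine heb (?_ : u ∈ ball t e)
      rw [mem_ball, Subtype.dist_eq] at ht' ⊢
      refine lt_of_le_of_lt ?_ ht'
      rw [dist_comm, dist_comm (t' : ℝ)]
      refine Real.dist_left_le_of_mem_uIcc ?_
      rw [mem_uIcc] at hu ⊢
      exact hu
    filter_upwards [ball_mem_nhds t he] with t' ht'
    have h1 := agreeNear_trans_iff (δ t) hrx hg hk hFg hGk (hsub t' ht')
    have h2 := agreeNear_trans_iff (δ t) hrx hg hk hFg hGk (hsub t (mem_ball_self he))
    rw [← hδ] at h1 h2
    exact propext (h1.trans h2.symm)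
  have h1 := hlc.apply_eq_of_isPreconnected isPreconnected_univ (mem_univ 1) (mem_univ 0)
  -- The end points `p 0` and `p 1` equal `base` and `z` only propositionally, so the classes are
  -- compared as points of `UCover`.
  have e0 : ∀ (x y : UCover), x = y → AgreeNear F G x.2 → AgreeNear F G y.2 := by
    rintro x y rfl h; exact h
  have h0 : AgreeNear F G (δ 0) := by
    refine e0 ⟨base, Path.Homotopic.Quotient.refl base⟩ ⟨p 0, δ 0⟩ ?_ h
    refine Sigma.ext p.source.symm ?_
    refine Path.Homotopic.hpath_hext fun t => ?_
    simp
  rw [← h1] at h0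
  refine e0 ⟨p 1, δ 1⟩ ⟨z, Path.Homotopic.Quotient.mk p⟩ ?_ h0
  refine Sigma.ext p.target ?_
  refine Path.Homotopic.hpath_hext fun t => ?_
  simp

theorem eq_of_agree_halfDisc {F G : UCover → ℂ} (hF : IsHolomorphic F) (hG : IsHolomorphic G)
    (h : ∀ (z : PuncturedPlane) (γ : Path base z),
      (∀ t : unitInterval, 0 < t → 0 < (γ t : ℂ).im) → ‖(z : ℂ)‖ < 1 →
        F ⟨z, Path.Homotopic.Quotient.mk γ⟩ = G ⟨z, Path.Homotopic.Quotient.mk γ⟩) : F = G := by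
  have hbase : AgreeNear F G (Path.Homotopic.Quotient.refl base) := by
    obtain ⟨r, hr, hrx, g, k, hg, hk, hFg, hGk⟩ :=
      exists_local_pair hF hG (Path.Homotopic.Quotient.refl base)
    have h1 := agreeNear_trans_iff _ hrx hg hk hFg hGk (p := Path.refl base)
      (fun t => by simpa using hr)
    rw [Path.Homotopic.Quotient.mk_refl, trans_refl] at h1
    refine h1.2 ?_
    obtain ⟨w, hw⟩ : ((ball (base : ℂ) r ∩ ball 0 1) ∩ {z : ℂ | 0 < z.im}).Nonempty := by
      have hr1 : r ≤ 1 := by rwa [radius_base] at hrx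
      -- The squared norm of this point is `1 - r/2 + r²/8`, less than `1` because `0 < r ≤ 1`.
      refine ⟨-1 + ((r / 4 : ℝ) : ℂ) * (1 + Complex.I), ⟨?_, ?_⟩, ?_⟩
      · rw [mem_ball, dist_eq_norm, coe_base]
        refine (Complex.norm_le_abs_re_add_abs_im _).trans_lt ?_
        have h4 : |r / 4| = r / 4 := abs_of_pos (by positivity)
        simp [h4]
        linarith
      · rw [mem_ball_zero_iff, ← sq_lt_one_iff₀ (norm_nonneg _), Complex.sq_norm,
          Complex.normSq_apply]
        simp
        nlinarith
      · simpa using hr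
    have hO : IsOpen ((ball (base : ℂ) r ∩ ball 0 1) ∩ {z : ℂ | 0 < z.im}) :=
      (isOpen_ball.inter isOpen_ball).inter (isOpen_lt continuous_const Complex.continuous_im)
    refine eqOn_ball_of_eventuallyEq hg hk hw.1.1 ?_
    filter_upwards [hO.mem_nhds hw] with z hz
    have him : 0 < z.im := hz.2
    let z' : PuncturedPlane := ⟨z, by rintro rfl; simp at him, by rintro rfl; simp at him⟩
    obtain ⟨p, hp, -, hpi⟩ := exists_line_base (z := z') him
    have hpb : ∀ t, (p t : ℂ) ∈ ball (base : ℂ) r := fun t => by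
      rw [hp]
      have := convex_ball (base : ℂ) r (mem_ball_self hr) hz.1.1 (sub_nonneg.2 t.2.2) t.2.1
        (by ring)
      simpa [coe_base] using this
    have e1 := hFg _ p hpb
    have e2 := hGk _ p hpb
    rw [refl_trans] at e1 e2
    rw [← (show (z' : ℂ) = z from rfl), ← e1, ← e2]
    exact h _ p hpi (by simpa using hz.1.2)
  funext ⟨z, γ⟩
  induction γ using Path.Homotopic.Quotient.ind with
  | mk p =>
    obtain ⟨r, hr, h1⟩ := agreeNear_of_agreeNear_refl hF hG hbase p
    have := h1 z (Path.refl z) (fun t => by simpa using hr)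
    rwa [Path.Homotopic.Quotient.mk_refl, trans_refl] at this

/-! ### The analytic continuations of the basis functions -/

/-- The values of `log` and the `u_k` at a point of the universal cover. -/
def contTuple (c : ℂ) (p : UCover) : ℕ → ℂ := transport c p.2 (initial c)

/-- The basis functions in terms of the solution of the differential system. -/
def evalFn (m : ℕ) (c : ℂ) (i : Fin (m + 1)) (v : ℕ → ℂ) : ℂ :=
  Complex.exp ((1 - c) * v 0) *
    if i = 0 then v m else v 0 ^ (m - (i : ℕ)) / ((m - (i : ℕ)).factorial : ℂ)

/-- The analytic continuation of `basisFn m c i` to the universal cover. -/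
def contFn (m : ℕ) (c : ℂ) (i : Fin (m + 1)) (p : UCover) : ℂ := evalFn m c i (contTuple c p)

theorem isHolomorphic_contFn (m : ℕ) (c : ℂ) (i : Fin (m + 1)) : IsHolomorphic (contFn m c i) := by
  intro z γ
  obtain ⟨S, hS, e⟩ := IsSol.exists (c := c) (zero_notMem_ball z) (one_notMem_ball z) z
    (transport c γ (initial c))
  refine ⟨radius z, radius_pos z, fun w => evalFn m c i (S w), ?_, ?_⟩
  · have h := hS.differentiableOn
    have h0 := h 0
    have hm := h m
    unfold evalFn
    split_ifs <;> fun_prop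
  · intro w p hp
    rw [contFn, contTuple, transport_trans, ← e, transport_of_isSol isOpen_ball hS hp]

/-- For `Im z > 0` the number `-iz` lies in the right half plane, so adding `π/2` to its argument
stays within the principal range. -/
theorem log_eq_log_mul_I {z : ℂ} (hz : 0 < z.im) :
    Complex.log (-Complex.I * z) + Real.pi / 2 * Complex.I = Complex.log z := by
  have hz0 : z ≠ 0 := by rintro rfl; simp at hz
  have h1 : Complex.exp (Complex.log (-Complex.I * z) + Real.pi / 2 * Complex.I) = z := by
    rw [Complex.exp_add, Complex.exp_log (by simp [hz0]), Complex.exp_pi_div_two_mul_I]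
    linear_combination (-z) * Complex.I_sq
  have h2 : |(-Complex.I * z).arg| < Real.pi / 2 :=
    Complex.abs_arg_lt_pi_div_two_iff.2 (.inl (by simpa using hz))
  rw [abs_lt] at h2
  have h3 : (Complex.log (-Complex.I * z) + Real.pi / 2 * Complex.I).im =
      (-Complex.I * z).arg + Real.pi / 2 := by
    have : (Real.pi / 2 : ℂ) = ((Real.pi / 2 : ℝ) : ℂ) := by push_cast; rfl
    rw [this, Complex.add_im, Complex.log_im, Complex.im_ofReal_mul, Complex.I_im, mul_one]
  have h4 := Complex.log_exp (x := Complex.log (-Complex.I * z) + Real.pi / 2 * Complex.I)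
    (by rw [h3]; linarith [Real.pi_pos]) (by rw [h3]; linarith)
  rw [h1] at h4
  exact h4.symm

theorem contTuple_halfDisc {c : ℂ} (hc : ∀ k : ℕ, c ≠ -(k : ℂ)) {z : PuncturedPlane}
    {γ : Path base z} (hγ : ∀ t : unitInterval, 0 < t → 0 < (γ t : ℂ).im) (hz : ‖(z : ℂ)‖ < 1) :
    contTuple c ⟨z, Path.Homotopic.Quotient.mk γ⟩ = seriesSol c (Complex.log z) := by
  have him : 0 < (z : ℂ).im := by simpa using hγ 1 zero_lt_one
  obtain ⟨p, hp, hpS, hpi⟩ := exists_line_base him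
  have hγS : ∀ t, (γ t : ℂ) ∈ upperSet := by
    intro t
    rcases eq_or_lt_of_le t.2.1 with h | h
    · right
      have : t = 0 := Subtype.ext h.symm
      rw [this, γ.source, coe_base]
    · exact .inl (hγ t h)
  have hhom : (Path.Homotopic.Quotient.mk γ) = Path.Homotopic.Quotient.mk p :=
    Path.Homotopic.Quotient.eq.2 (homotopic_of_convex convex_upperSet zero_notMem_upperSet
      one_notMem_upperSet hγS hpS)
  have h0 : ∀ t, (p t : ℂ) ≠ 0 := fun t => (p t).2.1
  have hslit : ∀ t, -Complex.I * (p t : ℂ) ∈ Complex.slitPlane := by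
    intro t
    rcases hpS t with h | h
    · left; simpa using h
    · right; rw [h]; simp
  have hpc : Continuous fun t => (p t : ℂ) := continuous_subtype_val.comp p.continuous
  -- The principal logarithm is cut through the base point `-1`. Rotating by `-i` moves the cut to
  -- the negative imaginary axis, which `upperSet` avoids.
  have := transport_initial hc (p := p)
    (ℓ := fun t => Complex.log (-Complex.I * p t) + Real.pi / 2 * Complex.I)
    ((Continuous.clog (by fun_prop) hslit).add continuous_const)
    (by
      simp only [p.source, coe_base, neg_mul_neg, mul_one, Complex.log_I]
      ring)
    (by
      intro t
      rw [Complex.exp_add, Complex.exp_log (by simp [h0]), Complex.exp_pi_div_two_mul_I]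
      linear_combination (-(p t : ℂ)) * Complex.I_sq)
    (by
      intro t
      rcases eq_or_lt_of_le t.2.1 with h | h
      · right
        have : t = 0 := Subtype.ext h.symm
        rw [this, p.source, coe_base]
      · left
        rw [hp]
        have ht := t.2.2
        have h1 : ‖(1 - ((t : ℝ) : ℂ)) * (-1)‖ = 1 - t := by
          rw [mul_neg_one, norm_neg]
          have : (1 - ((t : ℝ) : ℂ)) = ((1 - t : ℝ) : ℂ) := by push_cast; rfl
          rw [this, Complex.norm_of_nonneg (by linarith)]
        have h2 : ‖((t : ℝ) : ℂ) * z‖ = t * ‖(z : ℂ)‖ := by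
          rw [norm_mul, Complex.norm_of_nonneg h.le]
        refine (norm_add_le _ _).trans_lt ?_
        rw [h1, h2]
        nlinarith)
  rw [contTuple, hhom, this]
  simp only [p.target]
  rw [log_eq_log_mul_I him, extendedSol, if_pos]
  rw [Complex.log_re]
  exact Real.log_neg (norm_pos_iff.2 z.2.1) hz

theorem isAnalyticContinuation_contFn {m : ℕ} (hm : 1 ≤ m) {c : ℂ} (hc : ∀ k : ℕ, c ≠ -(k : ℂ))
    (i : Fin (m + 1)) : IsAnalyticContinuation (basisFn m c i) (contFn m c i) := by
  refine ⟨isHolomorphic_contFn m c i, fun z γ hγ hz => ?_⟩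
  rw [contFn, contTuple_halfDisc hc hγ hz, evalFn, basisFn]
  obtain ⟨k, rfl⟩ : ∃ k, m = k + 1 := ⟨m - 1, by omega⟩
  split_ifs with hi
  · simp only [seriesSol, Complex.exp_log z.2.1, deformedPolylog_eq]
    rw [← mul_assoc, ← Complex.exp_add]
    congr 1
    have : (1 - c) * Complex.log z + c * Complex.log z = Complex.log z := by ring
    rw [this, Complex.exp_log z.2.1]
  · simp only [seriesSol]
    rw [Complex.cpow_def_of_ne_zero z.2.1, mul_comm (Complex.log (z : ℂ)), mul_div_assoc]

/-! ### Transport along the loops `Z₀` and `Z₁` -/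

/-- The squared norm is `5/8 - (3/8) cos θ`: the circle is internally tangent to the unit circle at
`-1`. -/
theorem circleMap_cases (θ : ℝ) :
    ‖circleMap (-1 / 4) (3 / 4) θ‖ < 1 ∨ circleMap (-1 / 4) (3 / 4) θ = -1 := by
  have hre : (circleMap (-1 / 4) (3 / 4) θ).re = -1 / 4 + 3 / 4 * Real.cos θ := by
    rw [circleMap, Complex.add_re, Complex.re_ofReal_mul, Complex.exp_ofReal_mul_I_re]
    norm_num
  have him : (circleMap (-1 / 4) (3 / 4) θ).im = 3 / 4 * Real.sin θ := by
    rw [circleMap, Complex.add_im, Complex.im_ofReal_mul, Complex.exp_ofReal_mul_I_im]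
    norm_num
  rcases (Real.neg_one_le_cos θ).eq_or_lt with h | h
  · right
    have hs : Real.sin θ = 0 := by
      have := Real.sin_sq_add_cos_sq θ
      rw [← h] at this
      nlinarith
    apply Complex.ext
    · rw [hre, ← h]; norm_num
    · rw [him, hs]; norm_num
  · left
    rw [← sq_lt_one_iff₀ (norm_nonneg _), Complex.sq_norm, Complex.normSq_apply, hre, him]
    nlinarith [Real.sin_sq_add_cos_sq θ]

/-- Factor `-1/4 + (3/4) e^{iθ} = e^{iθ} (3/4 - e^{-iθ}/4)`. The second factor has positive real
part, so its principal logarithm plus `iθ` is a continuous logarithm along the arc. -/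
theorem transport_arc {c : ℂ} (hc : ∀ k : ℕ, c ≠ -(k : ℂ)) {y : PuncturedPlane} (θ₁ : ℝ)
    (h₀ : ‖(0 : ℂ) - (-1 / 4)‖ ≠ |(3 / 4 : ℝ)|) (h₁ : ‖(1 : ℂ) - (-1 / 4)‖ ≠ |(3 / 4 : ℝ)|)
    (hx : circleMap (-1 / 4) (3 / 4) Real.pi = base) (hy : circleMap (-1 / 4) (3 / 4) θ₁ = y) :
    transport c (Path.Homotopic.Quotient.mk
      (arc (-1 / 4) (3 / 4) h₀ h₁ Real.pi θ₁ base y hx hy)) (initial c) =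
      extendedSol c (Complex.log (3 / 4 - Complex.exp (-(θ₁ * Complex.I)) / 4) +
        θ₁ * Complex.I) := by
  have hslit : ∀ θ : ℝ, (3 / 4 - Complex.exp (-(θ * Complex.I)) / 4) ∈ Complex.slitPlane := by
    intro θ
    left
    have h1 := Complex.re_le_norm (Complex.exp (-(θ * Complex.I)) / 4)
    have h2 : ‖Complex.exp (-(θ * Complex.I)) / 4‖ = 1 / 4 := by
      rw [norm_div, ← neg_mul, ← Complex.ofReal_neg, Complex.norm_exp_ofReal_mul_I]
      norm_num
    rw [h2] at h1
    rw [Complex.sub_re]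
    have h3 : (3 / 4 : ℂ).re = 3 / 4 := by norm_num
    rw [h3]
    linarith
  have hmul : ∀ x : ℂ, (3 / 4 - Complex.exp (-x) / 4) * Complex.exp x =
      3 / 4 * Complex.exp x - 1 / 4 := fun x => by
    rw [Complex.exp_neg]
    field_simp [Complex.exp_ne_zero x]
  have h := transport_initial hc (p := arc (-1 / 4) (3 / 4) h₀ h₁ Real.pi θ₁ base y hx hy)
    (ℓ := fun t => Complex.log (3 / 4 - Complex.exp
      (-(((Real.pi + t * (θ₁ - Real.pi) : ℝ) : ℂ) * Complex.I)) / 4) +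
        ((Real.pi + t * (θ₁ - Real.pi) : ℝ) : ℂ) * Complex.I)
    ((Continuous.clog (by fun_prop) fun t => hslit _).add (by fun_prop))
    (by
      simp [Complex.exp_neg]
      norm_num)
    (by
      intro t
      rw [Complex.exp_add, Complex.exp_log (Complex.slitPlane_ne_zero (hslit _)), hmul]
      change _ = circleMap (-1 / 4) (3 / 4) (Real.pi + t * (θ₁ - Real.pi))
      rw [circleMap]
      push_cast
      ring)
    (fun t => circleMap_cases _)
  rw [h]
  simp

theorem transport_loopZ0 {c : ℂ} (hc : ∀ k : ℕ, c ≠ -(k : ℂ)) :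
    transport c (Path.Homotopic.Quotient.mk loopZ0) (initial c) =
      shift (Complex.exp (c * (2 * Real.pi * Complex.I))) (2 * Real.pi * Complex.I)
        (fun _ _ => 0) (initial c) := by
  rw [loopZ0, transport_arc hc]
  have h1 : Complex.exp (-(((3 * Real.pi : ℝ) : ℂ) * Complex.I)) = -1 := by
    rw [Complex.exp_neg, exp_pi_I_three]; norm_num
  have h2 : (3 / 4 - -1 / 4 : ℂ) = 1 := by norm_num
  rw [h1, h2, Complex.log_one, zero_add, extendedSol, if_neg (by simp)]
  have h3 : ((3 * Real.pi : ℝ) : ℂ) * Complex.I - Real.pi * Complex.I =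
      2 * Real.pi * Complex.I := by push_cast; ring
  rw [h3]

theorem transport_upperArc {c : ℂ} (hc : ∀ k : ℕ, c ≠ -(k : ℂ)) :
    transport c (Path.Homotopic.Quotient.mk upperArc) (initial c) =
      seriesSol c (Complex.log (1 / 2)) := by
  rw [upperArc, transport_arc hc]
  have h2 : (3 / 4 - Complex.exp (-(((0 : ℝ) : ℂ) * Complex.I)) / 4 : ℂ) = 1 / 2 := by
    simp; norm_num
  rw [h2, extendedSol, if_pos]
  · simp
  · rw [Complex.add_re, Complex.log_re]
    simp
    exact Real.log_pos one_lt_two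

theorem transport_refl (c : ℂ) (x : PuncturedPlane) (v : ℕ → ℂ) :
    transport c (Path.Homotopic.Quotient.refl x) v = v := by
  have : IsFlat c (Path.refl x) (fun _ => v) := by
    obtain ⟨S, hS, e⟩ := IsSol.exists (c := c) (zero_notMem_ball x) (one_notMem_ball x) x v
    exact IsFlat.of_isSol fun t => ⟨_, ball_mem_nhds _ (radius_pos x), S, hS, e,
      .of_forall fun _ => e⟩
  exact this.transport_eq

theorem transport_symm_transport (c : ℂ) {x y : PuncturedPlane} (p : Path x y) (v : ℕ → ℂ) :
    transport c (Path.Homotopic.Quotient.mk p.symm)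
      (transport c (Path.Homotopic.Quotient.mk p) v) = v := by
  rw [← transport_trans, ← Path.Homotopic.Quotient.mk_trans]
  have : Path.Homotopic.Quotient.mk (p.trans p.symm) = Path.Homotopic.Quotient.refl x := by
    rw [← Path.Homotopic.Quotient.mk_refl]
    exact (Path.Homotopic.Quotient.eq.2 ⟨Path.Homotopy.reflTransSymm p⟩).symm
  rw [this, transport_refl]

/-! ### The logarithmic singularity at `1` -/

/-- The functions added to the `u_k` by the monodromy around `1`. -/
def logPow : ℕ → ℂ → ℂ
  | 0, _ => 0
  | k + 1, w => -(2 * Real.pi * Complex.I) * (w ^ k / (k.factorial : ℂ))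

theorem hasDerivAt_pow_div_factorial (k : ℕ) (w : ℂ) :
    HasDerivAt (fun w : ℂ => w ^ (k + 1) / ((k + 1).factorial : ℂ)) (w ^ k / (k.factorial : ℂ)) w := by
  refine ((hasDerivAt_pow (k + 1) w).div_const _).congr_deriv ?_
  have h1 : ((k : ℂ) + 1) ≠ 0 := by exact_mod_cast Nat.succ_ne_zero k
  have h2 : (k.factorial : ℂ) ≠ 0 := by exact_mod_cast k.factorial_ne_zero
  rw [Nat.factorial_succ]
  push_cast [Nat.add_sub_cancel]
  field_simp

theorem hasDerivAt_logPow (k : ℕ) (w : ℂ) : HasDerivAt (logPow (k + 1)) (logPow k w) w := by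
  cases k with
  | zero =>
    have : logPow (0 + 1) = fun _ => -(2 * Real.pi * Complex.I) := by
      funext w; simp [logPow]
    rw [this]
    exact hasDerivAt_const _ _
  | succ k => exact (hasDerivAt_pow_div_factorial k w).const_mul _

theorem mem_slitPlane_of_mem_ball_one {z : ℂ} (hz : z ∈ ball (1 : ℂ) 1) : z ∈ Complex.slitPlane := by
  have h : ‖z - 1‖ < 1 := by simpa [dist_eq_norm] using hz
  simpa using Complex.mem_slitPlane_of_norm_lt_one h

/-- The holomorphic parts around `1` of the `u_k`. -/
theorem exists_regular_part (c : ℂ) (a : ℕ → ℂ) : ∃ R : ℕ → ℂ → ℂ, (∀ k, R k (1 / 2) = a k) ∧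
    (∀ z ∈ ball (1 : ℂ) 1, z ≠ 1 → HasDerivAt (R 0)
      ((Complex.exp (c * Complex.log z) / z - 1) / (1 - z)) z) ∧
    ∀ k, ∀ z ∈ ball (1 : ℂ) 1, z ≠ 1 → HasDerivAt (R (k + 1))
      (R k z / z - Complex.log z ^ (k + 1) / ((k + 1).factorial : ℂ) / (1 - z)) z := by
  have n0 : ∀ z ∈ ball (1 : ℂ) 1, z ≠ 0 := fun z hz =>
    Complex.slitPlane_ne_zero (mem_slitPlane_of_mem_ball_one hz)
  have hlog : DifferentiableOn ℂ Complex.log (ball 1 1) := fun z hz =>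
    (Complex.differentiableAt_log (mem_slitPlane_of_mem_ball_one hz)).differentiableWithinAt
  have hnhds : ball (1 : ℂ) 1 ∈ 𝓝 (1 : ℂ) := ball_mem_nhds _ one_pos
  -- The prescribed derivatives have removable singularities at `1`: `E 1 = 1` and `L k 1 = 0`. The
  -- difference quotient `dslope` fills them in, so primitives exist on the whole ball.
  have hds : ∀ f : ℂ → ℂ, DifferentiableOn ℂ f (ball 1 1) →
      DifferentiableOn ℂ (dslope f 1) (ball 1 1) := fun f hf =>
    (Complex.differentiableOn_dslope hnhds).2 hf
  let E : ℂ → ℂ := fun z => Complex.exp (c * Complex.log z) / z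
  have hE : DifferentiableOn ℂ E (ball 1 1) := by fun_prop (disch := assumption)
  let L : ℕ → ℂ → ℂ := fun k z => Complex.log z ^ (k + 1) / ((k + 1).factorial : ℂ)
  have hL : ∀ k, DifferentiableOn ℂ (L k) (ball 1 1) := fun k => by fun_prop
  obtain ⟨R₀, hR₀, hR₀'⟩ := exists_primitive (a := 1) (r := 1) (f := fun z => -dslope E 1 z)
    (hds E hE).neg (1 / 2) (a 0)
  have step : ∀ (k : ℕ) (f : {f : ℂ → ℂ // DifferentiableOn ℂ f (ball 1 1)}),
      ∃ g : {g : ℂ → ℂ // DifferentiableOn ℂ g (ball 1 1)}, g.1 (1 / 2) = a (k + 1) ∧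
        ∀ z ∈ ball (1 : ℂ) 1, HasDerivAt g.1 (f.1 z / z + dslope (L k) 1 z) z := by
    intro k f
    obtain ⟨g, hgy, hg⟩ := exists_primitive (a := 1) (r := 1)
      (f := fun z => f.1 z / z + dslope (L k) 1 z)
      ((f.2.div differentiableOn_id n0).add (hds _ (hL k))) (1 / 2) (a (k + 1))
    exact ⟨⟨g, fun z hz => (hg z hz).differentiableAt.differentiableWithinAt⟩, hgy, hg⟩
  choose next next_y next_deriv using step
  let w : ℕ → {f : ℂ → ℂ // DifferentiableOn ℂ f (ball 1 1)} := fun k =>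
    Nat.rec ⟨R₀, fun z hz => (hR₀' z hz).differentiableAt.differentiableWithinAt⟩ next k
  refine ⟨fun k => (w k).1, fun k => ?_, fun z hz hz1 => ?_, fun k z hz hz1 => ?_⟩
  · cases k with
    | zero => exact hR₀
    | succ k => exact next_y k (w k)
  · refine (hR₀' z hz).congr_deriv ?_
    rw [dslope_of_ne _ hz1, slope_def_field]
    simp only [E, Complex.log_one, mul_zero, Complex.exp_zero, div_one]
    rw [← div_neg, neg_sub]
  · refine (next_deriv k (w k) z hz).congr_deriv ?_
    rw [dslope_of_ne _ hz1, slope_def_field]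
    simp only [L, Complex.log_one, ne_eq, Nat.succ_ne_zero, not_false_eq_true, zero_pow, zero_div,
      sub_zero]
    rw [← neg_sub z 1, div_neg, sub_neg_eq_add]

/-- The solution around `1` with a given branch `l` of `log (1 - z)`. -/
def solAroundOne (R : ℕ → ℂ → ℂ) (l : ℂ → ℂ) (z : ℂ) : ℕ → ℂ
  | 0 => Complex.log z
  | k + 1 => R k z - Complex.log z ^ k / (k.factorial : ℂ) * l z

/-- By the product rule, the terms with denominator `1 - z` coming from `l'` cancel those built into
the derivatives of `R`. -/
theorem isSol_solAroundOne {c : ℂ} {R : ℕ → ℂ → ℂ} {U : Set ℂ} (hU : U ⊆ ball 1 1)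
    (hU1 : (1 : ℂ) ∉ U)
    (hR0 : ∀ z ∈ ball (1 : ℂ) 1, z ≠ 1 → HasDerivAt (R 0)
      ((Complex.exp (c * Complex.log z) / z - 1) / (1 - z)) z)
    (hR : ∀ k, ∀ z ∈ ball (1 : ℂ) 1, z ≠ 1 → HasDerivAt (R (k + 1))
      (R k z / z - Complex.log z ^ (k + 1) / ((k + 1).factorial : ℂ) / (1 - z)) z)
    {l : ℂ → ℂ} (hl : ∀ z ∈ U, HasDerivAt l (-1 / (1 - z)) z) :
    IsSol c U (solAroundOne R l) := by
  intro z hz k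
  have hz1 : z ≠ 1 := fun h => hU1 (h ▸ hz)
  have hz1' : 1 - z ≠ 0 := sub_ne_zero.2 hz1.symm
  have hslit := mem_slitPlane_of_mem_ball_one (hU hz)
  have hz0 := Complex.slitPlane_ne_zero hslit
  have hlog : HasDerivAt Complex.log (1 / z) z := by
    simpa using Complex.hasDerivAt_log hslit
  match k with
  | 0 => exact hlog
  | 1 =>
    have : (fun w => solAroundOne R l w 1) = fun w => R 0 w - l w := by
      funext w; simp [solAroundOne]
    rw [this]
    refine ((hR0 z (hU hz) hz1).sub (hl z hz)).congr_deriv ?_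
    simp only [rhs, solAroundOne]
    field_simp
    ring
  | k + 2 =>
    refine ((hR k z (hU hz) hz1).sub
      (((hasDerivAt_pow_div_factorial k _).comp z hlog).mul (hl z hz))).congr_deriv ?_
    simp only [rhs, solAroundOne, Function.comp]
    field_simp
    ring

theorem transport_circleAroundOne {c : ℂ} {v : ℕ → ℂ} (hv : v 0 = Complex.log (1 / 2)) :
    transport c (Path.Homotopic.Quotient.mk circleAroundOne) v = shift 1 0 logPow v := by
  -- These values make `solAroundOne` start at `v`: at `1/2` both `log z` and the initial branch of
  -- `log (1 - z)` equal `log (1/2)`.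
  obtain ⟨R, hRa, hR0, hR⟩ := exists_regular_part c fun k =>
    v (k + 1) + Complex.log (1 / 2) ^ k / (k.factorial : ℂ) * Complex.log (1 / 2)
  let p := circleAroundOne
  let lam : unitInterval → ℂ := fun t =>
    Complex.log (1 / 2) + ((2 * Real.pi * t : ℝ) : ℂ) * Complex.I
  have hp : ∀ t, 1 - (p t : ℂ) = 1 / 2 * Complex.exp (((2 * Real.pi * t : ℝ) : ℂ) * Complex.I) := by
    intro t
    change 1 - circleMap 1 (1 / 2) (Real.pi + t * (3 * Real.pi - Real.pi)) = _
    rw [circleMap]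
    have : ((Real.pi + t * (3 * Real.pi - Real.pi) : ℝ) : ℂ) * Complex.I =
        Real.pi * Complex.I + ((2 * Real.pi * t : ℝ) : ℂ) * Complex.I := by
      push_cast; ring
    rw [this, Complex.exp_add, Complex.exp_pi_mul_I]
    push_cast
    ring
  have hpball : ∀ t, (p t : ℂ) ∈ ball (1 : ℂ) 1 := by
    intro t
    rw [mem_ball, dist_comm, dist_eq_norm, hp, norm_mul, Complex.norm_exp_ofReal_mul_I]
    norm_num
  have hp1 : ∀ t, 1 - (p t : ℂ) ≠ 0 := fun t => sub_ne_zero.2 (p t).2.2.symm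
  have hflat : IsFlat c p (fun t => solAroundOne R (fun _ => lam t) (p t)) := by
    refine IsFlat.of_isSol fun t => ?_
    -- The local branch of `log (1 - z)` that takes the value `lam t` at `p t`; the ratio is near
    -- `1`, away from the cut.
    let l : ℂ → ℂ := fun z => lam t + Complex.log ((1 - z) / (1 - p t))
    let U : Set ℂ := ball 1 1 ∩ (fun z => (1 - z) / (1 - (p t : ℂ))) ⁻¹' Complex.slitPlane
    have hUo : IsOpen U := isOpen_ball.inter (Complex.isOpen_slitPlane.preimage (by fun_prop))
    refine ⟨U, hUo.mem_nhds ⟨hpball t, ?_⟩, solAroundOne R l, ?_, ?_, ?_⟩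
    · simp [div_self (hp1 t)]
    · refine isSol_solAroundOne inter_subset_left (fun h => ?_) hR0 hR fun z hz => ?_
      · have := h.2
        simp at this
      · have hz1 : 1 - z ≠ 0 := fun h => by
          have := hz.2
          simp [h] at this
        refine (((((hasDerivAt_id z).const_sub 1).div_const _).clog hz.2).const_add _).congr_deriv ?_
        have := hp1 t
        simp only [id]
        field_simp
    · funext k
      cases k <;> simp [solAroundOne, l, div_self (hp1 t)]
    · have hev : ∀ᶠ t' : unitInterval in 𝓝 t,
          (2 * Real.pi * (t' : ℝ) - 2 * Real.pi * t) ∈ Ioo (-Real.pi) Real.pi := by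
        have hcont : ContinuousAt (fun t' : unitInterval =>
            2 * Real.pi * (t' : ℝ) - 2 * Real.pi * t) t := by fun_prop
        refine hcont.eventually (Ioo_mem_nhds ?_ ?_) <;> simp [Real.pi_pos]
      filter_upwards [hev] with t' ht'
      have h1 : (1 - (p t' : ℂ)) / (1 - p t) =
          Complex.exp (((2 * Real.pi * (t' : ℝ) - 2 * Real.pi * t : ℝ) : ℂ) * Complex.I) := by
        rw [hp, hp, mul_div_mul_left _ _ (by norm_num), ← Complex.exp_sub]
        congr 1
        push_cast
        ring
      have h2 : l (p t') = lam t' := by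
        simp only [l, lam]
        rw [h1, Complex.log_exp (by simpa using ht'.1) (by simpa using ht'.2.le)]
        push_cast
        ring
      funext k
      cases k <;> simp [solAroundOne, h2]
  have h := hflat.transport_eq
  have e0 : solAroundOne R (fun _ => lam 0) (p 0) = v := by
    have : (p 0 : ℂ) = 1 / 2 := by rw [p.source]; rfl
    funext k
    cases k with
    | zero => simp only [solAroundOne, this, hv]
    | succ k =>
      simp only [solAroundOne, this, hRa, lam]
      simp
  have e1 : solAroundOne R (fun _ => lam 1) (p 1) = shift 1 0 logPow v := by
    have : (p 1 : ℂ) = 1 / 2 := by rw [p.target]; rfl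
    funext k
    cases k with
    | zero => simp only [solAroundOne, this, hv, shift, add_zero]
    | succ k =>
      simp only [solAroundOne, this, hRa, lam, shift, logPow, hv]
      simp only [Set.Icc.coe_one]
      push_cast
      ring
  rwa [e0, e1] at h

/-- The turn around `1` acts by a symmetry, which commutes with the transport back along
`upperArc.symm`; the way out and the way back then cancel. -/
theorem transport_loopZ1 {c : ℂ} (hc : ∀ k : ℕ, c ≠ -(k : ℂ)) :
    transport c (Path.Homotopic.Quotient.mk loopZ1) (initial c) = shift 1 0 logPow (initial c) := by
  rw [loopZ1, Path.Homotopic.Quotient.mk_trans, Path.Homotopic.Quotient.mk_trans, transport_trans,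
    transport_trans, transport_circleAroundOne, transport_shift (by simp) (fun _ => rfl)
      hasDerivAt_logPow, transport_symm_transport]
  rw [transport_upperArc hc]
  rfl

/-! ### The effect of the symmetries on the basis functions -/

theorem add_pow_div_factorial (a w : ℂ) (N : ℕ) :
    (w + a) ^ N / (N.factorial : ℂ) = ∑ k ∈ Finset.range (N + 1),
      a ^ k / (k.factorial : ℂ) * (w ^ (N - k) / ((N - k).factorial : ℂ)) := by
  rw [add_comm w a, add_pow, Finset.sum_div]
  refine Finset.sum_congr rfl fun k hk => ?_
  have hk : k ≤ N := Nat.lt_succ_iff.1 (Finset.mem_range.1 hk)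
  have h := Nat.choose_mul_factorial_mul_factorial hk
  have h1 : (k.factorial : ℂ) ≠ 0 := by exact_mod_cast k.factorial_ne_zero
  have h2 : ((N - k).factorial : ℂ) ≠ 0 := by exact_mod_cast (N - k).factorial_ne_zero
  have h3 : (N.factorial : ℂ) ≠ 0 := by exact_mod_cast N.factorial_ne_zero
  have h' : ((N.choose k : ℕ) : ℂ) * k.factorial * (N - k).factorial = N.factorial := by
    exact_mod_cast h
  rw [div_mul_div_comm, div_eq_div_iff h3 (mul_ne_zero h1 h2), ← h']
  ring

/-- Since `e^a = 1`, the factor `e^{(1-c)ℓ}` is multiplied by `e^{-ac}`; the binomial theorem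
expands the power of `ℓ + a`. -/
theorem evalFn_shift_of_ne_zero {m : ℕ} {c a : ℂ} (ha : Complex.exp a = 1) (q : ℂ)
    (h : ℕ → ℂ → ℂ) (v : ℕ → ℂ) {i : Fin (m + 1)} (hi : i ≠ 0) :
    evalFn m c i (shift q a h v) = ∑ j, (if i ≤ j then
      a ^ ((j : ℕ) - (i : ℕ)) / (((j : ℕ) - (i : ℕ)).factorial : ℂ) * Complex.exp (-(a * c))
      else 0) * evalFn m c j v := by
  have hexp : Complex.exp ((1 - c) * (v 0 + a)) =
      Complex.exp ((1 - c) * v 0) * Complex.exp (-(a * c)) := by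
    have : (1 - c) * (v 0 + a) = (1 - c) * v 0 + a + -(a * c) := by ring
    rw [this, Complex.exp_add, Complex.exp_add, ha, mul_one]
  let f : ℕ → ℂ := fun j => if (i : ℕ) ≤ j then
      a ^ (j - (i : ℕ)) / ((j - (i : ℕ)).factorial : ℂ) * Complex.exp (-(a * c)) *
        (Complex.exp ((1 - c) * v 0) * (v 0 ^ (m - j) / ((m - j).factorial : ℂ))) else 0
  have hf : ∀ j : Fin (m + 1), (if i ≤ j then
      a ^ ((j : ℕ) - (i : ℕ)) / (((j : ℕ) - (i : ℕ)).factorial : ℂ) * Complex.exp (-(a * c))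
      else 0) * evalFn m c j v = f j := by
    intro j
    by_cases hij : i ≤ j
    · have hj : j ≠ 0 := fun h => hi (Fin.le_zero_iff.1 (h ▸ hij))
      have hij' : (i : ℕ) ≤ j := hij
      simp only [f, if_pos hij, if_pos hij', evalFn, if_neg hj]
    · have hij' : ¬ (i : ℕ) ≤ j := hij
      simp only [f, if_neg hij, if_neg hij', zero_mul]
  have him : (i : ℕ) ≤ m + 1 := i.2.le
  rw [Finset.sum_congr rfl fun j _ => hf j, Fin.sum_univ_eq_sum_range f,
    ← Finset.sum_range_add_sum_Ico f him, Finset.sum_eq_zero, zero_add,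
    Finset.sum_Ico_eq_sum_range]
  · simp only [evalFn, if_neg hi, shift]
    rw [hexp, add_pow_div_factorial, Finset.mul_sum]
    have : m + 1 - (i : ℕ) = m - i + 1 := by have := i.2; omega
    rw [this]
    refine Finset.sum_congr rfl fun k _ => ?_
    simp only [f, if_pos (Nat.le_add_right _ _), Nat.add_sub_cancel_left, Nat.sub_sub]
    ring
  · intro j hj
    have : ¬ (i : ℕ) ≤ j := by simpa using hj
    simp only [f, if_neg this]

/-- The scaling `e^{ca}` of `u_m` cancels the factor `e^{-ac}` of `e^{(1-c)ℓ}`, which gives the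
diagonal entry `1`. -/
theorem evalFn_shift_zero {m : ℕ} (hm : 1 ≤ m) {c a : ℂ} (ha : Complex.exp a = 1)
    (h : ℕ → ℂ → ℂ) (v : ℕ → ℂ) :
    evalFn m c 0 (shift (Complex.exp (c * a)) a h v) =
      evalFn m c 0 v + Complex.exp (-(a * c)) * (Complex.exp ((1 - c) * v 0) * h m (v 0)) := by
  obtain ⟨k, rfl⟩ : ∃ k, m = k + 1 := ⟨m - 1, by omega⟩
  have hexp : Complex.exp ((1 - c) * (v 0 + a)) =
      Complex.exp ((1 - c) * v 0) * Complex.exp (-(a * c)) := by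
    have : (1 - c) * (v 0 + a) = (1 - c) * v 0 + a + -(a * c) := by ring
    rw [this, Complex.exp_add, Complex.exp_add, ha, mul_one]
  have h1 : Complex.exp (-(a * c)) * Complex.exp (c * a) = 1 := by
    rw [← Complex.exp_add]
    simp [mul_comm]
  simp only [evalFn, if_true, shift, hexp]
  linear_combination (Complex.exp ((1 - c) * v 0) * v (k + 1)) * h1

/-- The loop is followed first, so its symmetry is applied to the initial value and then commutes
with the transport along `p`. -/
theorem contTuple_translate {c a : ℂ} {h : ℕ → ℂ → ℂ} (h0 : ∀ w, h 0 w = 0)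
    (hh : ∀ k w, HasDerivAt (h (k + 1)) (h k w) w) {τ : Pi1}
    (hτ : transport c τ.toLoop (initial c) = shift (Complex.exp (c * a)) a h (initial c))
    (p : UCover) : contTuple c ⟨p.1, τ.toLoop.trans p.2⟩ =
      shift (Complex.exp (c * a)) a h (contTuple c p) := by
  rw [contTuple, transport_trans, hτ, transport_shift rfl h0 hh, contTuple]

/-! ### The translates of the basis functions -/

/-- `∑_{j < k} d (k - j) (w - w₀) ^ j / j!`. -/
def taylorPoly (w₀ : ℂ) (d : ℕ → ℂ) (k : ℕ) (w : ℂ) : ℂ :=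
  ∑ j ∈ Finset.range k, d (k - j) * ((w - w₀) ^ j / (j.factorial : ℂ))

theorem hasDerivAt_taylorPoly (w₀ : ℂ) (d : ℕ → ℂ) (k : ℕ) (w : ℂ) :
    HasDerivAt (taylorPoly w₀ d (k + 1)) (taylorPoly w₀ d k w) w := by
  have : taylorPoly w₀ d (k + 1) = fun w => ∑ j ∈ Finset.range k,
      d (k - j) * ((w - w₀) ^ (j + 1) / ((j + 1).factorial : ℂ)) + d (k + 1) := by
    funext w
    simp [taylorPoly, Finset.sum_range_succ']
  rw [this]
  refine HasDerivAt.add_const _ (HasDerivAt.fun_sum fun j _ => HasDerivAt.const_mul _ ?_)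
  exact ((hasDerivAt_pow_div_factorial j (w - w₀)).comp w
    ((hasDerivAt_id w).sub_const w₀)).congr_deriv (mul_one _)

theorem taylorPoly_self (w₀ : ℂ) (d : ℕ → ℂ) (k : ℕ) : taylorPoly w₀ d (k + 1) w₀ = d (k + 1) := by
  simp [taylorPoly, Finset.sum_range_succ']

/-- The change of `ℓ` is a multiple of `2πi` because `ℓ` remains a logarithm of the end point. The
numbers `d k` are the defects of the remaining coordinates, and `taylorPoly` takes these values at
`πi`, the initial value of `ℓ`. -/
theorem exists_shift_initial (c : ℂ) (τ : Path.Homotopic.Quotient base base) :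
    ∃ (n : ℤ) (d : ℕ → ℂ), transport c τ (initial c) =
      shift (Complex.exp (c * (n * (2 * Real.pi * Complex.I)))) (n * (2 * Real.pi * Complex.I))
        (taylorPoly (Real.pi * Complex.I) d) (initial c) := by
  have h1 : Complex.exp (transport c τ (initial c) 0) = Complex.exp (Real.pi * Complex.I) := by
    rw [exp_transport_zero, Complex.exp_pi_mul_I, coe_base]
    rw [initial_zero, Complex.exp_pi_mul_I, coe_base]
  obtain ⟨n, hn⟩ := Complex.exp_eq_exp_iff_exists_int.1 h1
  refine ⟨n, fun k => transport c τ (initial c) k -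
    Complex.exp (c * (n * (2 * Real.pi * Complex.I))) * initial c k, funext fun k => ?_⟩
  cases k with
  | zero => rw [hn, shift, initial_zero]
  | succ k => rw [shift, initial_zero, taylorPoly_self]; ring

/-- `w ^ (m - j) / (m - j)!` for `1 ≤ j ≤ m` span the polynomials of degree less than `m`. -/
theorem exists_taylorPoly_eq (w₀ : ℂ) (d : ℕ → ℂ) (m : ℕ) : ∃ r : Fin (m + 1) → ℂ, ∀ w,
    taylorPoly w₀ d m w = ∑ j : Fin (m + 1), if j = 0 then 0 else
      r j * (w ^ (m - (j : ℕ)) / ((m - (j : ℕ)).factorial : ℂ)) := by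
  let P : Polynomial ℂ := ∑ j ∈ Finset.range m,
    Polynomial.C (d (m - j) / (j.factorial : ℂ)) * (Polynomial.X - Polynomial.C w₀) ^ j
  have hP : ∀ w, taylorPoly w₀ d m w = P.eval w := by
    intro w
    simp only [taylorPoly, P, Polynomial.eval_finsetSum]
    refine Finset.sum_congr rfl fun j _ => ?_
    simp
    ring
  rcases Nat.eq_zero_or_pos m with rfl | hm
  · refine ⟨0, fun w => ?_⟩
    simp [taylorPoly]
  have hdeg : P.natDegree < m := by
    refine lt_of_le_of_lt (Polynomial.natDegree_sum_le_of_forall_le (n := m - 1) _ _ fun j hj => ?_)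
      (by omega)
    refine (Polynomial.natDegree_C_mul_le _ _).trans ?_
    rw [Polynomial.natDegree_pow, Polynomial.natDegree_X_sub_C]
    have := Finset.mem_range.1 hj
    omega
  refine ⟨fun j => P.coeff (m - j) * ((m - (j : ℕ)).factorial : ℂ), fun w => ?_⟩
  rw [hP, Polynomial.eval_eq_sum_range' hdeg, ← Finset.sum_range_reflect, Fin.sum_univ_succ,
    if_pos rfl, zero_add, ← Fin.sum_univ_eq_sum_range
      (fun j => P.coeff (m - 1 - j) * w ^ (m - 1 - j))]
  refine Finset.sum_congr rfl fun j _ => ?_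
  have h2 : ((m - (j.succ : ℕ)).factorial : ℂ) ≠ 0 := by
    exact_mod_cast Nat.factorial_ne_zero _
  rw [if_neg (Fin.succ_ne_zero j), mul_assoc, mul_div_cancel₀ _ h2]
  have : m - 1 - (j : ℕ) = m - (j.succ : ℕ) := by simp; omega
  rw [this]

/-- The translates of the basis functions: the matrices are upper triangular, with diagonal
entries `1, e^{-2πinc}, …, e^{-2πinc}`. -/
theorem exists_translate_eq {m : ℕ} (hm : 1 ≤ m) (c : ℂ) (τ : Pi1) :
    ∃ (n : ℤ) (M : Matrix (Fin (m + 1)) (Fin (m + 1)) ℂ),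
      (∀ i, translate τ (contFn m c i) = ∑ j, M i j • contFn m c j) ∧
      (∀ i j, j < i → M i j = 0) ∧
      ∀ i, M i i = if i = 0 then 1 else Complex.exp (-(n * (2 * Real.pi * Complex.I) * c)) := by
  obtain ⟨n, d, hτ⟩ := exists_shift_initial c τ.toLoop
  obtain ⟨r, hr⟩ := exists_taylorPoly_eq (Real.pi * Complex.I) d m
  set a : ℂ := n * (2 * Real.pi * Complex.I) with ha
  have hea : Complex.exp a = 1 := Complex.exp_int_mul_two_pi_mul_I n
  have htr := fun p => contTuple_translate (fun w => by simp [taylorPoly])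
    (hasDerivAt_taylorPoly (Real.pi * Complex.I) d) hτ p
  refine ⟨n, Matrix.of fun i j =>
    if i = 0 then (if j = 0 then 1 else Complex.exp (-(a * c)) * r j)
    else if i ≤ j then a ^ ((j : ℕ) - (i : ℕ)) / (((j : ℕ) - (i : ℕ)).factorial : ℂ) *
      Complex.exp (-(a * c)) else 0, fun i => ?_, fun i j hij => ?_, fun i => ?_⟩
  · funext p
    simp only [translate, contFn, htr, Finset.sum_apply, Pi.smul_apply, smul_eq_mul, Matrix.of_apply]
    by_cases hi : i = 0
    · subst hi
      rw [evalFn_shift_zero hm hea, hr]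
      simp only [if_true]
      rw [Fin.sum_univ_succ (fun j : Fin (m + 1) => (if j = 0 then 1 else
        Complex.exp (-(a * c)) * r j) * evalFn m c j (contTuple c p)), if_pos rfl, one_mul,
        Fin.sum_univ_succ, if_pos rfl, zero_add, Finset.mul_sum, Finset.mul_sum]
      congr 1
      refine Finset.sum_congr rfl fun j _ => ?_
      simp only [if_neg (Fin.succ_ne_zero j), evalFn]
      ring
    · rw [evalFn_shift_of_ne_zero hea _ _ _ hi]
      simp only [if_neg hi]
  · have hi : i ≠ 0 := by rintro rfl; exact absurd hij (Fin.not_lt_zero j)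
    simp only [Matrix.of_apply, if_neg hi, if_neg (not_le.2 hij)]
  · by_cases hi : i = 0
    · simp [hi]
    · simp [hi, ha]

theorem translate_classZ0 {m : ℕ} (hm : 1 ≤ m) {c : ℂ} (hc : ∀ k : ℕ, c ≠ -(k : ℂ))
    (i : Fin (m + 1)) :
    translate classZ0 (contFn m c i) = ∑ j, matrixZ0 m c i j • contFn m c j := by
  have hτ : transport c classZ0.toLoop (initial c) = _ := transport_loopZ0 hc
  have htr := fun p => contTuple_translate (fun w => rfl) (fun k w => hasDerivAt_const _ _) hτ p
  have hea := Complex.exp_two_pi_mul_I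
  funext p
  simp only [translate, contFn, htr, Finset.sum_apply, Pi.smul_apply, smul_eq_mul, matrixZ0,
    Matrix.of_apply]
  by_cases hi : i = 0
  · subst hi
    rw [evalFn_shift_zero hm hea]
    simp
  · rw [evalFn_shift_of_ne_zero hea _ _ _ hi]
    simp only [if_neg hi]

theorem translate_classZ1 {m : ℕ} (hm : 1 ≤ m) {c : ℂ} (hc : ∀ k : ℕ, c ≠ -(k : ℂ))
    (i : Fin (m + 1)) :
    translate classZ1 (contFn m c i) = ∑ j, matrixZ1 m i j • contFn m c j := by
  have hτ : transport c classZ1.toLoop (initial c) =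
      shift (Complex.exp (c * 0)) 0 logPow (initial c) := by
    rw [mul_zero, Complex.exp_zero]
    exact transport_loopZ1 hc
  have htr := fun p => contTuple_translate (fun w => rfl) hasDerivAt_logPow hτ p
  funext p
  simp only [translate, contFn, htr, Finset.sum_apply, Pi.smul_apply, smul_eq_mul, matrixZ1,
    Matrix.of_apply]
  by_cases hi : i = 0
  · subst hi
    obtain ⟨k, rfl⟩ : ∃ k, m = k + 1 := ⟨m - 1, by omega⟩
    rw [evalFn_shift_zero hm Complex.exp_zero, Fin.sum_univ_succ, Fin.sum_univ_succ]
    simp [evalFn, logPow, Fin.ext_iff]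
    ring
  · have hi' : (i : ℕ) ≠ 0 := fun h => hi (Fin.ext h)
    rw [evalFn_shift_of_ne_zero Complex.exp_zero _ _ _ hi]
    refine Finset.sum_congr rfl fun j _ => ?_
    congr 1
    have h01 : ¬((i : ℕ) = 0 ∧ (j : ℕ) = 1) := fun h => hi' h.1
    rw [if_neg h01]
    rcases lt_trichotomy i j with h | h | h
    · have : (j : ℕ) - (i : ℕ) ≠ 0 := by have : (i : ℕ) < j := h; omega
      rw [if_pos h.le, if_neg h.ne, zero_pow this]
      simp
    · simp [h]
    · rw [if_neg (not_le.2 h), if_neg h.ne']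

/-! ### Linear independence -/

/-- There are points of the universal cover over `-1` at which the continued logarithm takes the
values `πi + 2πin`. -/
theorem exists_contTuple_zero {c : ℂ} (hc : ∀ k : ℕ, c ≠ -(k : ℂ)) (n : ℕ) :
    ∃ γ : Path.Homotopic.Quotient base base, transport c γ (initial c) 0 =
      Real.pi * Complex.I + n * (2 * Real.pi * Complex.I) := by
  induction n with
  | zero => exact ⟨Path.Homotopic.Quotient.refl base, by rw [transport_refl, initial_zero]; simp⟩
  | succ n ih =>
    obtain ⟨γ, hγ⟩ := ih
    refine ⟨(Path.Homotopic.Quotient.mk loopZ0).trans γ, ?_⟩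
    rw [transport_trans, transport_loopZ0 hc,
      transport_shift rfl (fun _ => rfl) (fun _ _ => hasDerivAt_const _ _), shift, hγ]
    push_cast
    ring

theorem linearIndependent_contFn {m : ℕ} (hm : 1 ≤ m) {c : ℂ} (hc : ∀ k : ℕ, c ≠ -(k : ℂ)) :
    LinearIndependent ℂ (contFn m c) := by
  rw [Fintype.linearIndependent_iff]
  intro g hg
  have hg' : ∀ p, ∑ i, g i * contFn m c i p = 0 := fun p => by
    simpa [Finset.sum_apply] using congrFun hg p
  have hpi : (Real.pi : ℂ) * Complex.I ≠ 0 := by simp [Real.pi_ne_zero]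
  -- Compare the relation at the base point with its translate by `[Z₁]`: only `b₀` changes, by
  -- `-2πi b₁`, and `b₁` does not vanish at the base point.
  have hg0 : g 0 = 0 := by
    have h1 := hg' ⟨base, classZ1.toLoop.trans (Path.Homotopic.Quotient.refl base)⟩
    have h2 := hg' ⟨base, Path.Homotopic.Quotient.refl base⟩
    have h3 : ∀ i, contFn m c i ⟨base, classZ1.toLoop.trans (Path.Homotopic.Quotient.refl base)⟩ =
        contFn m c i ⟨base, Path.Homotopic.Quotient.refl base⟩ + if i = 0 then
          -(2 * Real.pi * Complex.I) * contFn m c 1 ⟨base, Path.Homotopic.Quotient.refl base⟩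
          else 0 := by
      intro i
      have := congrFun (translate_classZ1 hm hc i) ⟨base, Path.Homotopic.Quotient.refl base⟩
      simp only [translate, Finset.sum_apply, Pi.smul_apply, smul_eq_mul] at this
      rw [this]
      obtain ⟨k, rfl⟩ : ∃ k, m = k + 1 := ⟨m - 1, by omega⟩
      have hM : ∀ j : Fin (k + 1 + 1), matrixZ1 (k + 1) i j = (if i = j then 1 else 0) +
          (if j = 1 then (if i = 0 then -(2 * Real.pi * Complex.I) else 0) else 0) := by
        intro j
        simp only [matrixZ1, Matrix.of_apply, Fin.ext_iff, Fin.val_zero, Fin.val_one]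
        split_ifs <;> first | omega | simp
      simp [hM, add_mul, Finset.sum_add_distrib]
    simp only [h3, mul_add, Finset.sum_add_distrib] at h1
    rw [h2, zero_add] at h1
    simp only [mul_ite, mul_zero, Finset.sum_ite_eq', Finset.mem_univ, if_true] at h1
    have h4 : contFn m c 1 ⟨base, Path.Homotopic.Quotient.refl base⟩ ≠ 0 := by
      obtain ⟨k, rfl⟩ : ∃ k, m = k + 1 := ⟨m - 1, by omega⟩
      have h10 : (1 : Fin (k + 1 + 1)) ≠ 0 := by simp
      rw [contFn, evalFn, if_neg h10, contTuple, transport_refl, initial_zero]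
      refine mul_ne_zero (Complex.exp_ne_zero _) (div_ne_zero (pow_ne_zero _ hpi) ?_)
      exact_mod_cast Nat.factorial_ne_zero _
    have h5 : (2 * Real.pi * Complex.I : ℂ) ≠ 0 := by simp [Real.pi_ne_zero]
    simpa [h4, h5, Real.pi_ne_zero] using h1
  -- What remains is `e^{(1-c)ℓ} Q(ℓ)`. Over `-1` the logarithm takes infinitely many values, so `Q
  -- = 0`; the exponents `m - i` are distinct, so every coefficient vanishes.
  let Q : Polynomial ℂ := ∑ i : Fin (m + 1),
    Polynomial.monomial (m - (i : ℕ)) (if i = 0 then 0 else g i / ((m - (i : ℕ)).factorial : ℂ))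
  have hroot : ∀ n : ℕ, Q.IsRoot (Real.pi * Complex.I + n * (2 * Real.pi * Complex.I)) := by
    intro n
    obtain ⟨γ, hγ⟩ := exists_contTuple_zero hc n
    have h1 := hg' ⟨base, γ⟩
    simp only [contFn, evalFn, contTuple, hγ, mul_left_comm (g _), ← Finset.mul_sum] at h1
    have h2 := (mul_eq_zero.1 h1).resolve_left (Complex.exp_ne_zero _)
    rw [Polynomial.IsRoot, Polynomial.eval_finsetSum]
    refine Eq.trans ?_ h2
    refine Finset.sum_congr rfl fun i _ => ?_
    by_cases hi : i = 0
    · simp [hi, hg0]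
    · simp only [if_neg hi, Polynomial.eval_monomial]
      ring
  have hQ : Q = 0 := by
    refine Polynomial.eq_zero_of_infinite_isRoot Q (Set.infinite_of_injective_forall_mem
      (f := fun n : ℕ => (Real.pi * Complex.I + n * (2 * Real.pi * Complex.I) : ℂ)) ?_ hroot)
    intro n n' h
    have h5 : (2 * Real.pi * Complex.I : ℂ) ≠ 0 := by simp [Real.pi_ne_zero]
    have := mul_right_cancel₀ h5 (add_left_cancel h)
    exact_mod_cast this
  intro i
  by_cases hi : i = 0
  · rw [hi, hg0]
  · have h1 : Q.coeff (m - i) = g i / ((m - (i : ℕ)).factorial : ℂ) := by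
      simp only [Q, Polynomial.finsetSum_coeff, Polynomial.coeff_monomial]
      rw [Finset.sum_eq_single i]
      · simp [hi]
      · intro j _ hj
        have : m - (j : ℕ) ≠ m - i := fun h => hj (Fin.ext (by have := i.2; have := j.2; omega))
        rw [if_neg this]
      · simp
    rw [hQ, Polynomial.coeff_zero] at h1
    have h2 : ((m - (i : ℕ)).factorial : ℂ) ≠ 0 := by exact_mod_cast Nat.factorial_ne_zero _
    exact (div_eq_zero_iff.1 h1.symm).resolve_right h2

/-! ### The monodromy representation -/

theorem eq_of_sum_smul_eq {n : ℕ} {b : Fin n → UCover → ℂ} (hb : LinearIndependent ℂ b)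
    {A B : Matrix (Fin n) (Fin n) ℂ} (h : ∀ i, ∑ j, A i j • b j = ∑ j, B i j • b j) : A = B := by
  ext i j
  have := Fintype.linearIndependent_iff.1 hb (fun j => A i j - B i j) (by
    simp only [sub_smul, Finset.sum_sub_distrib, h i, sub_self]) j
  exact sub_eq_zero.1 this

theorem translate_mul (τ σ' : Pi1) (F : UCover → ℂ) :
    translate (τ * σ') F = translate σ' (translate τ F) := by
  funext p
  simp only [translate, Pi1.toLoop_mul, trans_assoc]

theorem translate_one (F : UCover → ℂ) : translate 1 F = F := by
  funext p
  have : (1 : Pi1).toLoop = Path.Homotopic.Quotient.refl base := rfl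
  simp only [translate, this, refl_trans]

theorem translate_sum {n : ℕ} (τ : Pi1) (a : Fin n → ℂ) (b : Fin n → UCover → ℂ) :
    translate τ (∑ j, a j • b j) = ∑ j, a j • translate τ (b j) := by
  funext p
  simp [translate, Finset.sum_apply]

/-- Translation reverses products, and so does writing the coefficients in rows; the two reversals
cancel and the matrices multiply in the order of `Pi1`. Invertibility is automatic, as `Pi1` is a
group. -/
theorem existsUnique_monodromyRep {n : ℕ} {b : Fin n → UCover → ℂ} (hb : LinearIndependent ℂ b)
    (h : ∀ τ, ∃ M : Matrix (Fin n) (Fin n) ℂ, ∀ i, translate τ (b i) = ∑ j, M i j • b j) :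
    ∃! ρ : Pi1 →* GL (Fin n) ℂ, IsMonodromyRep b ρ := by
  choose M hM using h
  let φ : Pi1 →* Matrix (Fin n) (Fin n) ℂ :=
    { toFun := M
      map_one' := eq_of_sum_smul_eq hb fun i => by
        rw [← hM, translate_one]
        simp [Matrix.one_apply, ite_smul]
      map_mul' := fun τ τ' => eq_of_sum_smul_eq hb fun i => by
        rw [← hM, translate_mul, hM τ, translate_sum]
        simp only [hM τ', Finset.smul_sum, smul_smul, Matrix.mul_apply, Finset.sum_smul]
        rw [Finset.sum_comm] }
  refine ⟨φ.toHomUnits, fun τ i => hM τ i, fun ρ hρ => ?_⟩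
  refine MonoidHom.ext fun τ => Units.ext (eq_of_sum_smul_eq hb fun i => ?_)
  rw [← hρ]
  exact hM τ i

/-! ### Triangular matrices -/

/-- Upper triangular matrices map each member of the standard flag into itself; equality follows by
applying this to the inverse, which also lies in `H`. -/
theorem exists_isBorelSubgroup {n : ℕ} (H : Subgroup (GL (Fin n) ℂ))
    (h : ∀ g ∈ H, ∀ i j, j < i → (g : Matrix (Fin n) (Fin n) ℂ) i j = 0) :
    ∃ B : Subgroup (GL (Fin n) ℂ), IsBorelSubgroup B ∧ H ≤ B := by
  let e := Pi.basisFun ℂ (Fin n)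
  have hmap : ∀ (g g' : GL (Fin n) ℂ) (U : Submodule ℂ (Fin n → ℂ)),
      U.map ((g * g' : GL (Fin n) ℂ) : Matrix (Fin n) (Fin n) ℂ).mulVecLin =
        (U.map (g' : Matrix (Fin n) (Fin n) ℂ).mulVecLin).map
          (g : Matrix (Fin n) (Fin n) ℂ).mulVecLin := fun g g' U => by
    rw [← Submodule.map_comp, ← Matrix.mulVecLin_mul, Units.val_mul]
  have hone : ∀ U : Submodule ℂ (Fin n → ℂ),
      U.map ((1 : GL (Fin n) ℂ) : Matrix (Fin n) (Fin n) ℂ).mulVecLin = U := fun U => by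
    rw [Units.val_one, Matrix.mulVecLin_one, Submodule.map_id]
  let B : Subgroup (GL (Fin n) ℂ) :=
    { carrier := {g | ∀ U ∈ e.toFlag, U.map (g : Matrix (Fin n) (Fin n) ℂ).mulVecLin = U}
      mul_mem' := fun {g g'} hg hg' U hU => by rw [hmap, hg' U hU, hg U hU]
      one_mem' := fun U _ => hone U
      inv_mem' := fun {g} hg U hU => by
        conv_lhs => rw [← hg U hU]
        rw [← hmap, inv_mul_cancel, hone] }
  refine ⟨B, ⟨e.toFlag, fun g => Iff.rfl⟩, fun g hg => ?_⟩
  have hle : ∀ g ∈ H, ∀ U ∈ e.toFlag, U.map (g : Matrix (Fin n) (Fin n) ℂ).mulVecLin ≤ U := by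
    intro g hg U hU
    obtain ⟨k, rfl⟩ := e.mem_toFlag.1 hU
    rw [Module.Basis.flag, Submodule.map_span_le]
    rintro _ ⟨i, hi, rfl⟩
    have : (g : Matrix (Fin n) (Fin n) ℂ).mulVecLin (e i) =
        ∑ l, (g : Matrix (Fin n) (Fin n) ℂ) l i • e l := by
      funext l
      simp [e, Matrix.mulVec_single, Pi.single_apply, Finset.sum_apply]
    rw [this]
    refine Submodule.sum_mem _ fun l _ => ?_
    rcases lt_or_ge i l with hil | hil
    · rw [h g hg l i hil, zero_smul]
      exact Submodule.zero_mem _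
    · exact Submodule.smul_mem _ _ (e.self_mem_flag (lt_of_le_of_lt hil hi))
  intro U hU
  refine le_antisymm (hle g hg U hU) ?_
  conv_lhs => rw [← hone U, ← mul_inv_cancel g, hmap]
  exact Submodule.map_mono (hle g⁻¹ (H.inv_mem hg) U hU)

/-- Each factor `X - M i i` of the characteristic polynomial divides `X^N - 1`, so the
characteristic polynomial divides `(X^N - 1)^n`, and Cayley–Hamilton gives `(M^N - 1)^n = 0`. -/
theorem isNilpotent_pow_sub_one_of_triangular {n : ℕ} {M : Matrix (Fin n) (Fin n) ℂ}
    (h : ∀ i j, j < i → M i j = 0) {N : ℕ} (hd : ∀ i, M i i ^ N = 1) :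
    IsNilpotent (M ^ N - 1) := by
  have hc : M.charpoly = ∏ i, (Polynomial.X - Polynomial.C (M i i)) :=
    Matrix.charpoly_of_isUpperTriangular M fun i j hij => h i j hij
  have hdvd : M.charpoly ∣ (Polynomial.X ^ N - 1 : Polynomial ℂ) ^ n := by
    have : (Polynomial.X ^ N - 1 : Polynomial ℂ) ^ n =
        ∏ _i : Fin n, (Polynomial.X ^ N - 1 : Polynomial ℂ) := by simp
    rw [hc, this]
    refine Finset.prod_dvd_prod_of_dvd _ _ fun i _ => ?_
    rw [Polynomial.dvd_iff_isRoot]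
    simp [hd i]
  obtain ⟨q, hq⟩ := hdvd
  refine ⟨n, ?_⟩
  have := congrArg (Polynomial.aeval M) hq
  rw [map_mul, Matrix.aeval_self_charpoly, zero_mul] at this
  simpa using this

end PolylogMonodromy

end

/-! ### The main theorem -/

theorem theorem2p9 (m : ℕ) (hm : 1 ≤ m) (c : ℂ) (hc : ∀ k : ℕ, c ≠ -(k : ℂ)) :
    (∃! b : Fin (m + 1) → UCover → ℂ, ∀ i, IsAnalyticContinuation (basisFn m c i) (b i)) ∧
    ∀ b : Fin (m + 1) → UCover → ℂ, (∀ i, IsAnalyticContinuation (basisFn m c i) (b i)) →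
      LinearIndependent ℂ b ∧
      (∃! ρ : Pi1 →* GL (Fin (m + 1)) ℂ, IsMonodromyRep b ρ) ∧
      ∀ ρ : Pi1 →* GL (Fin (m + 1)) ℂ, IsMonodromyRep b ρ →
        (ρ classZ0 : Matrix (Fin (m + 1)) (Fin (m + 1)) ℂ) = matrixZ0 m c ∧
        (ρ classZ1 : Matrix (Fin (m + 1)) (Fin (m + 1)) ℂ) = matrixZ1 m ∧
        (∃ B : Subgroup (GL (Fin (m + 1)) ℂ), IsBorelSubgroup B ∧ ρ.range ≤ B) ∧
        ((∃ k : ℤ, 1 ≤ k ∧ c = (k : ℂ)) → IsUnipotentSubgroup ρ.range) ∧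
        ((∃ q : ℚ, c = (q : ℂ)) → (∀ k : ℤ, c ≠ (k : ℂ)) →
          IsQuasiUnipotentSubgroup ρ.range) := by
  have hcont : ∀ i, IsAnalyticContinuation (basisFn m c i) (contFn m c i) :=
    isAnalyticContinuation_contFn hm hc
  have huniq : ∀ b : Fin (m + 1) → UCover → ℂ,
      (∀ i, IsAnalyticContinuation (basisFn m c i) (b i)) → b = contFn m c := fun b hb =>
    funext fun i => eq_of_agree_halfDisc (hb i).1 (hcont i).1 fun z γ hγ hz => by
      rw [(hb i).2 z γ hγ hz, (hcont i).2 z γ hγ hz]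
  refine ⟨⟨contFn m c, hcont, huniq⟩, fun b hb => ?_⟩
  rw [huniq b hb]
  have hli := linearIndependent_contFn hm hc
  refine ⟨hli, existsUnique_monodromyRep hli fun τ => ?_, fun ρ hρ => ?_⟩
  · obtain ⟨-, M, hM, -⟩ := exists_translate_eq hm c τ
    exact ⟨M, hM⟩
  have htri : ∀ g ∈ ρ.range, ∃ n : ℤ,
      (∀ i j, j < i → (g : Matrix (Fin (m + 1)) (Fin (m + 1)) ℂ) i j = 0) ∧
      ∀ i, (g : Matrix (Fin (m + 1)) (Fin (m + 1)) ℂ) i i =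
        if i = 0 then 1 else Complex.exp (-(n * (2 * Real.pi * Complex.I) * c)) := by
    rintro _ ⟨τ, rfl⟩
    obtain ⟨n, M, hM, h1, h2⟩ := exists_translate_eq hm c τ
    have : (ρ τ : Matrix (Fin (m + 1)) (Fin (m + 1)) ℂ) = M :=
      eq_of_sum_smul_eq hli fun i => by rw [← hρ, hM]
    exact ⟨n, by rw [this]; exact h1, by rw [this]; exact h2⟩
  -- If `N c` is an integer, the `N`-th powers of the diagonal entries `e^{-2πinc}` are `1`. This is
  -- used with `N = 1` for integral `c` and with `N` the denominator for rational `c`.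
  have hnil : ∀ N k : ℤ, 0 ≤ N → N * c = k → ∀ g ∈ ρ.range,
      IsNilpotent ((g : Matrix (Fin (m + 1)) (Fin (m + 1)) ℂ) ^ N.toNat - 1) := by
    intro N k hN hk g hg
    obtain ⟨n, h1, h2⟩ := htri g hg
    refine isNilpotent_pow_sub_one_of_triangular h1 fun i => ?_
    rw [h2]
    split_ifs
    · simp
    · rw [← Complex.exp_nat_mul, Complex.exp_eq_one_iff]
      have : ((N.toNat : ℕ) : ℂ) = (N : ℂ) := by
        exact_mod_cast congrArg (Int.cast (R := ℂ)) (Int.toNat_of_nonneg hN)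
      refine ⟨-(n * k), ?_⟩
      rw [this]
      push_cast
      rw [← hk]
      ring
  refine ⟨?_, ?_, ?_, ?_, ?_⟩
  · exact eq_of_sum_smul_eq hli fun i => by rw [← hρ, translate_classZ0 hm hc]
  · exact eq_of_sum_smul_eq hli fun i => by rw [← hρ, translate_classZ1 hm hc]
  · exact exists_isBorelSubgroup _ fun g hg => (htri g hg).choose_spec.1
  · rintro ⟨k, -, hk⟩ g hg
    simpa using hnil 1 k zero_le_one (by simp [hk]) g hg
  · rintro ⟨q, hq⟩ -
    refine ⟨q.den, q.den_pos, fun g hg => ?_⟩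
    refine hnil q.den q.num (Int.natCast_nonneg _) ?_ g hg
    rw [hq]
    have := q.den_mul_eq_num
    have h : ((q.den * q : ℚ) : ℂ) = ((q.num : ℚ) : ℂ) := by rw [this]
    push_cast at h ⊢
    exact h
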